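/- **Setting.** Let $m,u\ge 1$ be integers, $n=m+u$, $\mathcal X\subseteq\mathbb R^d$, $\mathcal Y\subseteq\mathbb R$, and let $(x_i,y_i)_{i=1}^n$ be a full sample in $\mathcal X\times\mathcal Y$. For a function $h$ on $\mathcal X\times\mathcal Y$ write $h(i)=h(x_i,y_i)$, $\mathcal L_n(h)=\frac1n\sum_{i=1}^n h(i)$ and $T_n(h)=\frac1n\sum_{i=1}^n h(i)^2$. Let $\mathbf d=(d_1,\dots,d_u)$ have independent entries, $d_i$ uniform on $\{i,\dots,n\}$, and let $\mathbf Z_{\mathbf d}$ be the vector of $u$ indices obtained as follows: start with the array $I=(1,\dots,n)$ and, for $i=1,\dots,u$, put $\mathbf Z_{\mathbf d}(i)=I(d_i)$ and then swap the values $I(i)$ and $I(d_i)$. (So $\{\mathbf Z_{\mathbf d}\}$ is drawn uniformly without replacement from $[n]$.) The set $\{\mathbf Z_{\mathbf d}\}$ is the test index set and its complement $\overline{\mathbf Z_{\mathbf d}}$ the training index set. Put $\mathcal U_h(\mathbf d)=\frac1u\sum_{i\in\{\mathbf Z_{\mathbf d}\}}h(i)$, $\mathcal L^{(m)}_h(\mathbf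 d)=\frac1m\sum_{i\in\overline{\mathbf Z_{\mathbf d}}}h(i)$, $R^+_{u,\mathbf d}h=\mathcal U_h(\mathbf d)-\mathcal L_n(h)$, $R^+_{m,\mathbf d}h=\mathcal L^{(m)}_h(\mathbf d)-\mathcal L_n(h)$, $R^-_{u,\mathbf d}=-R^+_{u,\mathbf d}$ and $R^-_{m,\mathbf d}=-R^+_{m,\mathbf d}$. The operator $R^+_{\min\{u,m\},\mathbf d}$ is $R^+_{u,\mathbf d}$ if $u\le m$ and $R^+_{m,\mathbf d}$ otherwise. Let $\mathcal F$ be a class of functions $f:\mathcal X\to\mathbb R$, $\ell$ a loss, $\ell_f(x,y)=\ell(f(x),y)$, and suppose that $0\le\ell_f(i)\le L_0$ for all $f\in\mathcal F$ and $i\in[n]$, where $L_0\ge2\sqrt2$. For each $\mathbf d$ let $\hat f_{\mathbf d,u}\in\operatorname{argmin}_{f\in\mathcal F}\mathcal U_{\ell_f}(\mathbf d)$ (the test oracle) and $\hat f_{\mathbf d,m}\in\operatorname{argmin}_{f\in\mathcal F}\mathcal L^{(m)}_{\ell_f}(\mathbf d)$ (the empirical minimizer). A function $\psi:[0,\infty)\to[0,\infty)$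 is sub-root if it is nondecreasing and $r\mapsto\psi(r)/\sqrt r$ is nonincreasing on $(0,\infty)$. Its fixed point is the largest $r\ge0$ with $\psi(r)=r$, that is, the unique positive fixed point if $\psi\not\equiv0$, and $0$ if $\psi\equiv0$. **Main Assumption.** (1) There is $f^*_n\in\mathcal F$ with $\mathcal L_n(\ell_{f^*_n})=\inf_{f\in\mathcal F}\mathcal L_n(\ell_f)$. (2) There is a constant $B$ such that $T_n(h)\le B\,\mathcal L_n(h)$ for every $h\in\Delta^*_{\mathcal F}:=\{\ell_f-\ell_{f^*_n}:f\in\mathcal F\}$. **Theorem.** For all $B$ and $L_0\ge2\sqrt2$ there is a constant $c_2>0$, depending only on $B$ and $L_0$, such that the following holds in every setting as above that satisfies the Main Assumption with the constant $B$. Let $\psi_{u,m}$ be a sub-root function with fixed point $r^*$ such that for all $r\ge r^*$ $$\psi_{u,m}(r)\ge\max\Big\{\mathbb E\sup_{h\in\Delta^*_{\mathcal F},\,B\mathcal L_n(h)\le r}R^-_{u,\mathbf d}h,\ \ \mathbb E\sup_{h\in\Delta^*_{\mathcal F},\,B\mathcal L_n(h)\le r}R^-_{m,\mathbf d}h,\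 \ \mathbb E\sup_{h\in\Delta^*_{\mathcal F},\,B\mathcal L_n(h)\le r}R^+_{\min\{u,m\},\mathbf d}h^2\Big\}.$$ Then for every $x>0$, with probability at least $1-e^{-x}$ over $\mathbf d$, both $$\mathcal L_n(\ell_{\hat f_{\mathbf d,u}}-\ell_{f^*_n})\le c_2\Big(r^*+\frac xu\Big)\quad\text{and}\quad\mathcal L_n(\ell_{\hat f_{\mathbf d,m}}-\ell_{f^*_n})\le c_2\Big(r^*+\frac xm\Big).$$ -/

import Mathlib

open MeasureTheory

namespace Transductive

/-! ### Sampling without replacement -/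

/-- Range of the `i`-th draw, `{i, …, n}` in one-based numbering, for `n = m + u`
(indices are zero-based here). -/
abbrev DrawRange (m u : ℕ) (i : Fin u) : Type :=
  {j : Fin (m + u) // (i : ℕ) ≤ (j : ℕ)}

instance instNonemptyDrawRange (m u : ℕ) (i : Fin u) : Nonempty (DrawRange m u i) :=
  ⟨⟨Fin.natAdd m i, by simp⟩⟩

/-- A vector of draws `d = (d_1, …, d_u)`, with `d_i` in `{i, …, n}`. -/
abbrev Draws (m u : ℕ) : Type := (i : Fin u) → DrawRange m u i

/-- The law of `d`: independent coordinates, the `i`-th one uniform on `{i, …, n}`. -/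
noncomputable def drawLaw (m u : ℕ) : Measure (Draws m u) :=
  Measure.pi fun i => (PMF.uniformOfFintype (DrawRange m u i)).toMeasure

/-- The array `I` of the algorithm RANDPERM after its first `k` steps: it starts as the identity
on `[n]`, and step `i` swaps the values stored at the positions `i` and `d_i`. -/
def permArray {m u : ℕ} (d : Draws m u) : ℕ → Equiv.Perm (Fin (m + u))
  | 0 => 1
  | k + 1 =>
    if hk : k < u then
      permArray d k * Equiv.swap ⟨k, by omega⟩ (d ⟨k, hk⟩).1
    else permArray d k

/-- The output `Z_d` of RANDPERM: step `i` outputs the value stored at position `d_i`,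
before the swap of that step. -/
def Z {m u : ℕ} (d : Draws m u) (i : Fin u) : Fin (m + u) :=
  permArray d i (d i).1

/-- The set of test indices `{Z_d}`. -/
def testSet {m u : ℕ} (d : Draws m u) : Finset (Fin (m + u)) :=
  Finset.univ.image (Z d)

/-- The set of training indices, the complement of `{Z_d}`. -/
def trainSet {m u : ℕ} (d : Draws m u) : Finset (Fin (m + u)) :=
  (testSet d)ᶜ

/-! ### Losses and empirical averages

`S i` is the labelled point `(x_i, y_i)` of the full sample, and `h (S i)` is `h(i)`. -/

section Functionals

variable {α β : Type*} {m u : ℕ}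

/-- The function `ℓ_f (x, y) = ℓ (f x, y)`. -/
def lossFun (ℓ : ℝ → β → ℝ) (f : α → ℝ) : α × β → ℝ :=
  fun p => ℓ (f p.1) p.2

/-- The full-sample average `L_n(h)`, with `n = m + u`. -/
noncomputable def fullAvg (S : Fin (m + u) → α × β) (h : α × β → ℝ) : ℝ :=
  (1 / ((m + u : ℕ) : ℝ)) * ∑ i, h (S i)

/-- The average square `T_n(h) = L_n(h²)`. -/
noncomputable def fullSqAvg (S : Fin (m + u) → α × β) (h : α × β → ℝ) : ℝ :=
  (1 / ((m + u : ℕ) : ℝ)) * ∑ i, h (S i) ^ 2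

/-- The test average `U_h^{(u)}(Z_d)`. -/
noncomputable def testAvg (S : Fin (m + u) → α × β) (d : Draws m u) (h : α × β → ℝ) : ℝ :=
  (1 / (u : ℝ)) * ∑ i ∈ testSet d, h (S i)

/-- The training average `L_h^{(m)}` over the complement of `{Z_d}`. -/
noncomputable def trainAvg (S : Fin (m + u) → α × β) (d : Draws m u) (h : α × β → ℝ) : ℝ :=
  (1 / (m : ℝ)) * ∑ i ∈ trainSet d, h (S i)

/-- `R⁺_{u,d} h`. -/
noncomputable def Rplus_u (S : Fin (m + u) → α × β) (d : Draws m u) (h : α × β → ℝ) : ℝ :=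
  testAvg S d h - fullAvg S h

/-- `R⁺_{m,d} h`. -/
noncomputable def Rplus_m (S : Fin (m + u) → α × β) (d : Draws m u) (h : α × β → ℝ) : ℝ :=
  trainAvg S d h - fullAvg S h

/-- `R⁻_{u,d} h`. -/
noncomputable def Rminus_u (S : Fin (m + u) → α × β) (d : Draws m u) (h : α × β → ℝ) : ℝ :=
  -Rplus_u S d h

/-- `R⁻_{m,d} h`. -/
noncomputable def Rminus_m (S : Fin (m + u) → α × β) (d : Draws m u) (h : α × β → ℝ) : ℝ :=
  -Rplus_m S d h

/-- `R⁺_{min(u,m),d} h`. For `u = m` the two candidates have the same law. -/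
noncomputable def Rplus_min (S : Fin (m + u) → α × β) (d : Draws m u) (h : α × β → ℝ) : ℝ :=
  if u ≤ m then Rplus_u S d h else Rplus_m S d h

/-- `E_d [ sup_{h ∈ H} R_d h ]`. -/
noncomputable def expSup (R : Draws m u → (α × β → ℝ) → ℝ) (H : Set (α × β → ℝ)) : ℝ :=
  ∫ d, sSup (R d '' H) ∂(drawLaw m u)

/-- `Δ*_F = { ℓ_f - ℓ_{f*} : f ∈ F }`. -/
def deltaStar (ℓ : ℝ → β → ℝ) (F : Set (α → ℝ)) (fstar : α → ℝ) : Set (α × β → ℝ) :=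
  {h | ∃ f ∈ F, h = lossFun ℓ f - lossFun ℓ fstar}

/-- The localized class `{ h ∈ Δ*_F : B L_n(h) ≤ r }`. -/
def localDeltaStar (S : Fin (m + u) → α × β) (ℓ : ℝ → β → ℝ) (F : Set (α → ℝ))
    (fstar : α → ℝ) (B r : ℝ) : Set (α × β → ℝ) :=
  {h | h ∈ deltaStar ℓ F fstar ∧ B * fullAvg S h ≤ r}

/-- The Main Assumption: `f*` minimizes the full-sample loss over `F`, and
`T_n(h) ≤ B L_n(h)` on `Δ*_F`. -/
structure MainAssumption (S : Fin (m + u) → α × β) (ℓ : ℝ → β → ℝ) (F : Set (α → ℝ))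
    (fstar : α → ℝ) (B : ℝ) : Prop where
  mem : fstar ∈ F
  isMinOn : IsMinOn (fun f => fullAvg S (lossFun ℓ f)) F fstar
  sqAvg_le : ∀ h ∈ deltaStar ℓ F fstar, fullSqAvg S h ≤ B * fullAvg S h

end Functionals

/-! ### Sub-root functions -/

/-- Sub-root functions `[0,∞) → [0,∞)`; only the values on `[0,∞)` matter. -/
structure IsSubRoot (ψ : ℝ → ℝ) : Prop where
  nonneg : ∀ r, 0 ≤ r → 0 ≤ ψ r
  mono : MonotoneOn ψ (Set.Ici 0)
  anti : AntitoneOn (fun r => ψ r / √r) (Set.Ioi 0)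

/-- `r` is *the* fixed point of the sub-root function `ψ`: the largest solution of `ψ r = r` in
`[0,∞)`. A sub-root function that is not identically zero has exactly one positive fixed point,
and this is it (`0` may be a second, spurious one, as for `ψ = √`); for `ψ = 0` it is `0`. -/
def IsTheFixedPoint (ψ : ℝ → ℝ) (r : ℝ) : Prop :=
  IsGreatest {s | 0 ≤ s ∧ ψ s = s} r

end Transductive

/-!
The deviation of a test sum, maximised over a class, is a function on the slice of `u`-subsets
of `[n]`. On the slice a modified logarithmic Sobolev inequality holds for the exchange dynamics,
by induction on the ground set: conditioning on the membership of one point and averaging over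
that point splits the entropy. Herbst's argument turns it into exponential upper tails for
functions whose exchange variation is bounded by an affine function of themselves. The supremum
`Z` of the deviations is not of this kind, since its variation is controlled by the supremum `W`
of the deviations of the squares, but `Z + W` plus a constant is. This yields a Talagrand
inequality whose variance term is the mean square radius `r` of the class. Applied to each level
set `B * fullAvg S h ≤ r` separately and peeled over geometric values of `r`, with the sub-root
bound on the means, it shows that the excess loss exceeds a multiple of `rstar + x / c`, for a test
or training set of size `c`, only with small probability.
-/

namespace Transductive

section RandomPermutation

variable {m u : ℕ}

lemma permArray_succ (d : Draws m u) {k : ℕ} (hk : k < u) :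
    permArray d (k + 1) = permArray d k * Equiv.swap ⟨k, by omega⟩ (d ⟨k, hk⟩).1 := by
  simp [permArray, hk]

lemma permArray_succ_apply_self (d : Draws m u) (i : Fin u) :
    permArray d (i + 1) ⟨i, by omega⟩ = Z d i := by
  rw [permArray_succ d i.2]
  simp [Z]

lemma permArray_apply_of_lt (d : Draws m u) (i : Fin u) {k : ℕ} (hk : (i : ℕ) < k) :
    permArray d k ⟨i, by omega⟩ = Z d i := by
  induction k, hk using Nat.le_induction with
  | base => exact permArray_succ_apply_self d i
  | succ k hik ih =>
    by_cases hku : k < u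
    · have hd : k ≤ ((d ⟨k, hku⟩).1 : ℕ) := (d ⟨k, hku⟩).2
      rw [permArray_succ d hku, Equiv.Perm.mul_apply, Equiv.swap_apply_of_ne_of_ne, ih] <;>
        rw [Ne, Fin.ext_iff] <;> simp only <;> omega
    · simpa only [permArray, hku, dite_false] using ih

lemma Z_injective (d : Draws m u) : Function.Injective (Z d) := by
  intro i j h
  rw [← permArray_apply_of_lt d i i.2, ← permArray_apply_of_lt d j j.2] at h
  simpa [Fin.ext_iff] using h

lemma permArray_eq_and_draws_eq_of_Z_eq {d d' : Draws m u} (h : Z d = Z d') {k : ℕ} (hk : k ≤ u) :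
    permArray d k = permArray d' k ∧ ∀ i : Fin u, (i : ℕ) < k → d i = d' i := by
  induction k with
  | zero => exact ⟨rfl, fun i hi => absurd hi (Nat.not_lt_zero _)⟩
  | succ k ih =>
    obtain ⟨harray, hdraws⟩ := ih (by omega)
    have hdk : d ⟨k, hk⟩ = d' ⟨k, hk⟩ := by
      have hZ := congrFun h ⟨k, hk⟩
      simp only [Z, harray] at hZ
      exact Subtype.ext ((permArray d' k).injective hZ)
    refine ⟨by rw [permArray_succ d hk, permArray_succ d' hk, harray, hdk], fun i hi => ?_⟩
    rcases Nat.lt_succ_iff_lt_or_eq.1 hi with hlt | heq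
    · exact hdraws i hlt
    · rwa [show i = ⟨k, hk⟩ from Fin.ext heq]

lemma Z_left_injective : Function.Injective (Z : Draws m u → Fin u → Fin (m + u)) :=
  fun _ _ h => funext fun i => (permArray_eq_and_draws_eq_of_Z_eq h le_rfl).2 i i.2

lemma card_drawRange (i : Fin u) : Fintype.card (DrawRange m u i) = m + u - i := by
  have hIci : (Finset.univ.filter fun j : Fin (m + u) => (i : ℕ) ≤ (j : ℕ)) =
      Finset.Ici (⟨i, by omega⟩ : Fin (m + u)) := by
    ext j
    simp [Fin.le_def]
  rw [Fintype.card_subtype, hIci, Fin.card_Ici]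

lemma card_draws : Fintype.card (Draws m u) = Fintype.card (Fin u ↪ Fin (m + u)) := by
  rw [Fintype.card_pi, Fintype.card_embedding_eq, Fintype.card_fin, Fintype.card_fin,
    Nat.descFactorial_eq_prod_range, ← Fin.prod_univ_eq_prod_range (fun i => m + u - i) u]
  exact Finset.prod_congr rfl fun i _ => card_drawRange i

/-- The output `Z_d` of RANDPERM as an injection; `d ↦ zEmb d` is a bijection onto all injections,
which is why RANDPERM samples uniformly without replacement. -/
def zEmb (d : Draws m u) : Fin u ↪ Fin (m + u) := ⟨Z d, Z_injective d⟩

lemma zEmb_bijective : Function.Bijective (zEmb : Draws m u → (Fin u ↪ Fin (m + u))) := by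
  rw [Fintype.bijective_iff_injective_and_card]
  exact ⟨fun d d' h => Z_left_injective (congrArg DFunLike.coe h), card_draws⟩

lemma testSet_eq_map (d : Draws m u) : testSet d = Finset.univ.map (zEmb d) := by
  rw [Finset.map_eq_image]
  rfl

lemma card_testSet (d : Draws m u) : (testSet d).card = u := by
  rw [testSet_eq_map, Finset.card_map, Finset.card_univ, Fintype.card_fin]

lemma card_trainSet (d : Draws m u) : (trainSet d).card = m := by
  rw [trainSet, Finset.card_compl, card_testSet, Fintype.card_fin, Nat.add_sub_cancel]

lemma exists_perm_map_eq {α : Type*} [Finite α] {S T : Finset α} (h : S.card = T.card) :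
    ∃ σ : Equiv.Perm α, S.map σ.toEmbedding = T := by
  classical
  have e : S ≃ T := Finset.equivOfCardEq h
  refine ⟨e.extendSubtype, Finset.eq_of_subset_of_card_le ?_ (by rw [Finset.card_map, h])⟩
  intro y hy
  obtain ⟨x, hx, rfl⟩ := Finset.mem_map.1 hy
  exact Equiv.extendSubtype_mem e x hx

lemma card_embedding_image_eq {α : Type*} [Fintype α] [DecidableEq α] {S T : Finset α}
    (h : S.card = T.card) :
    (Finset.univ.filter fun e : Fin u ↪ α => Finset.univ.map e = S).card =
      (Finset.univ.filter fun e : Fin u ↪ α => Finset.univ.map e = T).card := by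
  obtain ⟨σ, rfl⟩ := exists_perm_map_eq h
  refine Finset.card_equiv (Equiv.embeddingCongr (Equiv.refl _) σ) fun e => ?_
  have hmap : Finset.univ.map (Equiv.embeddingCongr (Equiv.refl (Fin u)) σ e) =
      (Finset.univ.map e).map σ.toEmbedding := by
    rw [Finset.map_map]
    congr 1
  simp only [Finset.mem_filter, Finset.mem_univ, true_and, hmap, Finset.map_inj]

lemma exists_sum_testSet_eq_mul :
    ∃ c : ℕ, ∀ φ : Finset (Fin (m + u)) → ℝ,
      ∑ d : Draws m u, φ (testSet d) = c * ∑ T ∈ Finset.univ.powersetCard u, φ T := by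
  obtain ⟨T₀, hT₀⟩ : ((Finset.univ : Finset (Fin (m + u))).powersetCard u).Nonempty :=
    Finset.powersetCard_nonempty.2 (by simp)
  refine ⟨(Finset.univ.filter fun e : Fin u ↪ Fin (m + u) => Finset.univ.map e = T₀).card,
    fun φ => ?_⟩
  have hmaps : ∀ e ∈ (Finset.univ : Finset (Fin u ↪ Fin (m + u))),
      Finset.univ.map e ∈ (Finset.univ : Finset (Fin (m + u))).powersetCard u := by
    simp [Finset.mem_powersetCard]
  simp only [testSet_eq_map]
  rw [zEmb_bijective.sum_comp fun e => φ (Finset.univ.map e),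
    ← Finset.sum_fiberwise_of_maps_to hmaps, Finset.mul_sum]
  refine Finset.sum_congr rfl fun T hT => ?_
  rw [Finset.sum_congr rfl fun e he => by rw [(Finset.mem_filter.1 he).2], Finset.sum_const,
    nsmul_eq_mul, card_embedding_image_eq (T := T₀)]
  rw [(Finset.mem_powersetCard.1 hT).2, (Finset.mem_powersetCard.1 hT₀).2]

instance : IsProbabilityMeasure (drawLaw m u) := by
  unfold drawLaw
  infer_instance

lemma drawLaw_real_singleton (d : Draws m u) :
    (drawLaw m u).real {d} = 1 / (Fintype.card (Draws m u) : ℝ) := by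
  rw [drawLaw, measureReal_def, Measure.pi_singleton, ENNReal.toReal_prod, Fintype.card_pi,
    Nat.cast_prod, one_div, ← Finset.prod_inv_distrib]
  refine Finset.prod_congr rfl fun i _ => ?_
  rw [PMF.toMeasure_apply_singleton _ _ (measurableSet_singleton _), PMF.uniformOfFintype_apply]
  simp

theorem integral_testSet (φ : Finset (Fin (m + u)) → ℝ) :
    ∫ d, φ (testSet d) ∂(drawLaw m u) =
      (∑ T ∈ Finset.univ.powersetCard u, φ T) / ((m + u).choose u : ℝ) := by
  obtain ⟨c, hc⟩ := exists_sum_testSet_eq_mul (m := m) (u := u)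
  have hcard : (Fintype.card (Draws m u) : ℝ) = c * ((m + u).choose u : ℝ) := by
    simpa using hc fun _ => 1
  have hne : (c : ℝ) * ((m + u).choose u : ℝ) ≠ 0 := by
    rw [← hcard]
    exact_mod_cast Fintype.card_ne_zero
  have hc0 : (c : ℝ) ≠ 0 := left_ne_zero_of_mul hne
  rw [integral_fintype Integrable.of_finite]
  simp only [drawLaw_real_singleton, smul_eq_mul]
  rw [← Finset.mul_sum, hc, hcard, one_div_mul_eq_div, mul_div_mul_left _ _ hc0]

end RandomPermutation

section Entropy

/-- The integrand `(a - b) (log a - log b)` of the symmetrized relative entropy (Jeffreys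
divergence). It is the energy density for which the modified logarithmic Sobolev inequality on
`k`-subsets is stated. -/
noncomputable def jeffreys (a b : ℝ) : ℝ :=
  (a - b) * (Real.log a - Real.log b)

lemma jeffreys_self (a : ℝ) : jeffreys a a = 0 := by
  simp [jeffreys]

lemma jeffreys_comm (a b : ℝ) : jeffreys a b = jeffreys b a := by
  simp only [jeffreys]
  ring

lemma jeffreys_nonneg {a b : ℝ} (ha : 0 < a) (hb : 0 < b) : 0 ≤ jeffreys a b := by
  rcases le_total a b with h | h
  · exact mul_nonneg_of_nonpos_of_nonpos (sub_nonpos.2 h) (sub_nonpos.2 (Real.log_le_log ha h))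
  · exact mul_nonneg (sub_nonneg.2 h) (sub_nonneg.2 (Real.log_le_log hb h))

lemma jeffreys_mul {c a b : ℝ} (hc : c ≠ 0) (ha : a ≠ 0) (hb : b ≠ 0) :
    jeffreys (c * a) (c * b) = c * jeffreys a b := by
  rw [jeffreys, jeffreys, Real.log_mul hc ha, Real.log_mul hc hb]
  ring

lemma tangent_le_mul_log_sub_log {a b a₀ b₀ : ℝ} (ha : 0 < a) (hb : 0 < b) (ha₀ : 0 < a₀)
    (hb₀ : 0 < b₀) :
    a * (Real.log a₀ - Real.log b₀) + a - b * (a₀ / b₀) ≤ a * (Real.log a - Real.log b) := by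
  have hlog := Real.log_le_sub_one_of_pos (x := (b * a₀) / (a * b₀)) (by positivity)
  rw [Real.log_div (by positivity) (by positivity), Real.log_mul hb.ne' ha₀.ne',
    Real.log_mul ha.ne' hb₀.ne'] at hlog
  have hmul := mul_le_mul_of_nonneg_left hlog ha.le
  have hcancel : a * (b * a₀ / (a * b₀) - 1) = b * (a₀ / b₀) - a := by field_simp
  rw [hcancel] at hmul
  linarith

lemma tangent_le_jeffreys {a b a₀ b₀ : ℝ} (ha : 0 < a) (hb : 0 < b) (ha₀ : 0 < a₀)
    (hb₀ : 0 < b₀) :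
    a * (Real.log a₀ - Real.log b₀ + 1 - b₀ / a₀) + b * (Real.log b₀ - Real.log a₀ + 1 - a₀ / b₀)
      ≤ jeffreys a b := by
  have hab := tangent_le_mul_log_sub_log ha hb ha₀ hb₀
  have hba := tangent_le_mul_log_sub_log hb ha hb₀ ha₀
  rw [jeffreys]
  linarith

lemma jeffreys_sum_le_sum {ι : Type*} {s : Finset ι} (hs : s.Nonempty) {a b : ι → ℝ}
    (ha : ∀ i ∈ s, 0 < a i) (hb : ∀ i ∈ s, 0 < b i) :
    jeffreys (∑ i ∈ s, a i) (∑ i ∈ s, b i) ≤ ∑ i ∈ s, jeffreys (a i) (b i) := by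
  have hA := Finset.sum_pos ha hs
  have hB := Finset.sum_pos hb hs
  -- Sum the tangent plane inequalities at the point of the two totals.
  refine le_trans (le_of_eq ?_)
    (Finset.sum_le_sum fun i hi => tangent_le_jeffreys (ha i hi) (hb i hi) hA hB)
  rw [Finset.sum_add_distrib, ← Finset.sum_mul, ← Finset.sum_mul, jeffreys]
  field_simp
  ring

lemma jeffreys_exp_le (a b : ℝ) :
    jeffreys (Real.exp a) (Real.exp b) ≤
      Real.exp a * (max (a - b) 0) ^ 2 + Real.exp b * (max (b - a) 0) ^ 2 := by
  have hmul_le : ∀ {a b : ℝ}, b ≤ a →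
      (Real.exp a - Real.exp b) * (a - b) ≤ Real.exp a * (a - b) ^ 2 := by
    intro a b hab
    have htangent : Real.exp a * (b - a + 1) ≤ Real.exp b := by
      have := mul_le_mul_of_nonneg_left (Real.add_one_le_exp (b - a)) (Real.exp_pos a).le
      rwa [← Real.exp_add, add_sub_cancel] at this
    nlinarith [sub_nonneg.2 hab]
  rw [jeffreys, Real.log_exp, Real.log_exp]
  rcases le_total b a with h | h
  · rw [max_eq_left (by linarith), max_eq_right (by linarith)]
    linarith [hmul_le h]
  · rw [max_eq_right (by linarith), max_eq_left (by linarith)]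
    linarith [hmul_le h]

/-- The entropy `∑ f log f - (∑ f) log (mean of f)` of `f` on the finite set `s`, with respect to
the counting measure: `#s` times the entropy under the uniform distribution on `s`. -/
noncomputable def finEnt {ι : Type*} (s : Finset ι) (f : ι → ℝ) : ℝ :=
  ∑ i ∈ s, f i * Real.log (f i) - (∑ i ∈ s, f i) * Real.log ((∑ i ∈ s, f i) / s.card)

lemma finEnt_of_card_eq_one {ι : Type*} {s : Finset ι} (hs : s.card = 1) (f : ι → ℝ) :
    finEnt s f = 0 := by
  obtain ⟨i, rfl⟩ := Finset.card_eq_one.1 hs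
  simp [finEnt]

lemma finEnt_image {ι κ : Type*} [DecidableEq κ] {s : Finset ι} {g : ι → κ}
    (hg : Set.InjOn g s) (f : κ → ℝ) : finEnt (s.image g) f = finEnt s (f ∘ g) := by
  simp only [finEnt, Finset.sum_image hg, Finset.card_image_of_injOn hg, Function.comp_apply]

lemma mul_log_div_add_mul_log_div_le {F₁ F₂ N₁ N₂ : ℝ} (hF₁ : 0 < F₁) (hF₂ : 0 < F₂)
    (hN₁ : 0 < N₁) (hN₂ : 0 < N₂) :
    F₁ * Real.log (F₁ / N₁) + F₂ * Real.log (F₂ / N₂) ≤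
      (F₁ + F₂) * Real.log ((F₁ + F₂) / (N₁ + N₂)) +
        jeffreys (N₂ * F₁) (N₁ * F₂) / (N₁ + N₂) := by
  have hconcave := strictConcaveOn_log_Ioi.concaveOn.2 (div_pos hF₁ hN₁) (div_pos hF₂ hN₂)
    (div_pos hN₁ (add_pos hN₁ hN₂)).le (div_pos hN₂ (add_pos hN₁ hN₂)).le (by field_simp)
  have hmean : N₁ / (N₁ + N₂) * (F₁ / N₁) + N₂ / (N₁ + N₂) * (F₂ / N₂) =
      (F₁ + F₂) / (N₁ + N₂) := by field_simp
  simp only [smul_eq_mul, hmean] at hconcave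
  have hmul := mul_le_mul_of_nonneg_left hconcave (add_pos hF₁ hF₂).le
  rw [jeffreys, Real.log_mul hN₂.ne' hF₁.ne', Real.log_mul hN₁.ne' hF₂.ne']
  rw [Real.log_div hF₁.ne' hN₁.ne', Real.log_div hF₂.ne' hN₂.ne'] at hmul ⊢
  refine le_trans (le_of_eq ?_) (add_le_add_left hmul _)
  field_simp
  ring

lemma finEnt_union_le {ι : Type*} [DecidableEq ι] {s t : Finset ι} (hst : Disjoint s t)
    (hs : s.Nonempty) (ht : t.Nonempty) {f : ι → ℝ} (hf : ∀ i, 0 < f i) :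
    finEnt (s ∪ t) f ≤ finEnt s f + finEnt t f +
      jeffreys (t.card * ∑ i ∈ s, f i) (s.card * ∑ i ∈ t, f i) / (s.card + t.card) := by
  have hlog := mul_log_div_add_mul_log_div_le (Finset.sum_pos (fun i _ => hf i) hs)
    (Finset.sum_pos (fun i _ => hf i) ht) (Nat.cast_pos.2 hs.card_pos)
    (Nat.cast_pos.2 ht.card_pos)
  simp only [finEnt, Finset.sum_union hst, Finset.card_union_of_disjoint hst, Nat.cast_add]
  linarith

end Entropy

section Slice

variable {α : Type*} [DecidableEq α]

lemma disjoint_powersetCard_succ_image_insert {A : Finset α} {a : α} (ha : a ∉ A) (k : ℕ) :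
    Disjoint (A.powersetCard (k + 1)) ((A.powersetCard k).image (insert a)) := by
  rw [Finset.disjoint_left]
  intro S hS hS'
  obtain ⟨T, -, rfl⟩ := Finset.mem_image.1 hS'
  exact ha ((Finset.mem_powersetCard.1 hS).1 (Finset.mem_insert_self _ _))

lemma injOn_insert_powersetCard {A : Finset α} {a : α} (ha : a ∉ A) (k : ℕ) :
    Set.InjOn (insert a) (A.powersetCard k : Set (Finset α)) :=
  Finset.insert_erase_invOn.2.injOn.mono fun _ hT =>
    Finset.notMem_mono (Finset.mem_powersetCard.1 hT).1 ha

lemma sum_powersetCard_succ_insert {A : Finset α} {a : α} (ha : a ∉ A) (k : ℕ)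
    (F : Finset α → ℝ) :
    ∑ S ∈ (insert a A).powersetCard (k + 1), F S =
      ∑ T ∈ A.powersetCard k, F (insert a T) + ∑ T ∈ A.powersetCard (k + 1), F T := by
  rw [Finset.powersetCard_succ_insert ha,
    Finset.sum_union (disjoint_powersetCard_succ_image_insert ha k), add_comm,
    Finset.sum_image (injOn_insert_powersetCard ha k)]

lemma sum_powersetCard_sum_sdiff (A : Finset α) (k : ℕ) (F : Finset α → α → ℝ) :
    ∑ T ∈ A.powersetCard k, ∑ j ∈ A \ T, F (insert j T) j =
      ∑ S ∈ A.powersetCard (k + 1), ∑ j ∈ S, F S j := by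
  rw [Finset.sum_sigma', Finset.sum_sigma']
  refine Finset.sum_bij' (fun p _ => ⟨insert p.2 p.1, p.2⟩) (fun p _ => ⟨p.1.erase p.2, p.2⟩)
    ?_ ?_ ?_ ?_ fun _ _ => rfl
  · rintro ⟨T, j⟩ h
    simp only [Finset.mem_sigma, Finset.mem_powersetCard, Finset.mem_sdiff] at h ⊢
    exact ⟨⟨Finset.insert_subset h.2.1 h.1.1, by rw [Finset.card_insert_of_notMem h.2.2, h.1.2]⟩,
      Finset.mem_insert_self _ _⟩
  · rintro ⟨S, j⟩ h
    simp only [Finset.mem_sigma, Finset.mem_powersetCard, Finset.mem_sdiff] at h ⊢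
    exact ⟨⟨(Finset.erase_subset _ _).trans h.1.1, by
      rw [Finset.card_erase_of_mem h.2, h.1.2, Nat.add_sub_cancel]⟩, h.1.1 h.2,
      Finset.notMem_erase _ _⟩
  · rintro ⟨T, j⟩ h
    simp only [Finset.mem_sigma, Finset.mem_sdiff] at h
    simp [Finset.erase_insert h.2.2]
  · rintro ⟨S, j⟩ h
    simp only [Finset.mem_sigma] at h
    simp [Finset.insert_erase h.2]

/-- The sum of `H S S'` over the ordered pairs of `k`-subsets `S, S'` of `A` that differ by the
exchange of one element. With `H S S' = jeffreys (f S) (f S')` this is the Dirichlet form of the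
exchange walk on `k`-subsets. -/
noncomputable def exchangeSum (A : Finset α) (k : ℕ) (H : Finset α → Finset α → ℝ) : ℝ :=
  ∑ S ∈ A.powersetCard k, ∑ i ∈ S, ∑ j ∈ A \ S, H S (insert j (S.erase i))

lemma exchangeSum_zero (A : Finset α) (H : Finset α → Finset α → ℝ) :
    exchangeSum A 0 H = 0 := by
  simp [exchangeSum]

lemma exchangeSum_nonneg (A : Finset α) (k : ℕ) {H : Finset α → Finset α → ℝ}
    (hH : ∀ S T, 0 ≤ H S T) : 0 ≤ exchangeSum A k H :=
  Finset.sum_nonneg fun _ _ => Finset.sum_nonneg fun _ _ => Finset.sum_nonneg fun _ _ => hH _ _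

-- A pair of neighbours is recorded by its intersection `T`; the added diagonal terms vanish.
lemma exchangeSum_succ (A : Finset α) (k : ℕ) {H : Finset α → Finset α → ℝ}
    (hH : ∀ S, H S S = 0) :
    exchangeSum A (k + 1) H =
      ∑ T ∈ A.powersetCard k, ∑ i ∈ A \ T, ∑ j ∈ A \ T, H (insert i T) (insert j T) := by
  have hpairs := sum_powersetCard_sum_sdiff A k fun S i =>
    ∑ j ∈ A \ S.erase i, H S (insert j (S.erase i))
  refine Eq.trans ?_ (hpairs.symm.trans ?_)
  · refine Finset.sum_congr rfl fun S hS => Finset.sum_congr rfl fun i hi => ?_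
    rw [Finset.sdiff_erase ((Finset.mem_powersetCard.1 hS).1 hi),
      Finset.sum_insert (by simp [hi]), Finset.insert_erase hi, hH, zero_add]
  · refine Finset.sum_congr rfl fun T _ => Finset.sum_congr rfl fun i hi => ?_
    rw [Finset.erase_insert (Finset.mem_sdiff.1 hi).2]

lemma exchangeSum_comm (A : Finset α) (k : ℕ) {H : Finset α → Finset α → ℝ}
    (hH : ∀ S, H S S = 0) :
    exchangeSum A k (fun S T => H T S) = exchangeSum A k H := by
  cases k with
  | zero => simp only [exchangeSum_zero]
  | succ k =>
    rw [exchangeSum_succ A k hH, exchangeSum_succ A k (H := fun S T => H T S) hH]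
    exact Finset.sum_congr rfl fun T _ => Finset.sum_comm

lemma exchangeSum_erase_add (A : Finset α) (k : ℕ) {H : Finset α → Finset α → ℝ}
    (hH : ∀ S, H S S = 0) {a : α} (ha : a ∈ A) :
    exchangeSum (A.erase a) k (fun S T => H (insert a S) (insert a T)) +
        exchangeSum (A.erase a) (k + 1) H =
      ∑ T ∈ A.powersetCard k, ∑ i ∈ (A \ T).erase a, ∑ j ∈ (A \ T).erase a,
        H (insert i T) (insert j T) := by
  rw [exchangeSum_succ _ _ hH]
  simp only [← Finset.erase_sdiff_comm]
  cases k with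
  | zero => simp [exchangeSum_zero]
  | succ k =>
    rw [exchangeSum_succ _ _ fun S => hH (insert a S)]
    conv_rhs => rw [← Finset.insert_erase ha, Finset.erase_insert (Finset.notMem_erase a A),
      sum_powersetCard_succ_insert (Finset.notMem_erase a A)]
    congr 1
    refine Finset.sum_congr rfl fun T _ => ?_
    rw [Finset.sdiff_insert, Finset.erase_eq_of_notMem (s := A.erase a \ T) (by simp)]
    simp only [Finset.insert_comm a]

lemma sum_sum_erase_erase {A C : Finset α} (hCA : C ⊆ A) {D : α → α → ℝ}
    (hD : ∀ i, D i i = 0) :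
    ∑ a ∈ A, ∑ i ∈ C.erase a, ∑ j ∈ C.erase a, D i j =
      ((A.card : ℝ) - 2) * ∑ i ∈ C, ∑ j ∈ C, D i j := by
  have hindicator : ∀ a ∈ A, ∑ i ∈ C.erase a, ∑ j ∈ C.erase a, D i j =
      ∑ i ∈ C, ∑ j ∈ C, if a ≠ i ∧ a ≠ j then D i j else 0 := by
    intro a _
    rw [← Finset.filter_ne C a, Finset.sum_filter]
    refine Finset.sum_congr rfl fun i _ => ?_
    rw [Finset.sum_filter]
    split_ifs with h
    · exact Finset.sum_congr rfl fun j _ => by simp [h]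
    · simp [h]
  rw [Finset.sum_congr rfl hindicator, Finset.sum_comm, Finset.mul_sum]
  refine Finset.sum_congr rfl fun i hi => ?_
  rw [Finset.sum_comm, Finset.mul_sum]
  refine Finset.sum_congr rfl fun j hj => ?_
  rcases eq_or_ne i j with rfl | hij
  · simp [hD]
  have hfilter : A.filter (fun a => a ≠ i ∧ a ≠ j) = A \ {i, j} := by
    ext a
    simp
  rw [← Finset.sum_filter, hfilter, Finset.sum_const, nsmul_eq_mul,
    Finset.cast_card_sdiff (Finset.insert_subset (hCA hi) (Finset.singleton_subset_iff.2 (hCA hj))),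
    Finset.card_pair hij, Nat.cast_ofNat]

lemma sum_exchangeSum_erase_add (A : Finset α) (k : ℕ) {H : Finset α → Finset α → ℝ}
    (hH : ∀ S, H S S = 0) :
    ∑ a ∈ A, (exchangeSum (A.erase a) k (fun S T => H (insert a S) (insert a T)) +
        exchangeSum (A.erase a) (k + 1) H) =
      ((A.card : ℝ) - 2) * exchangeSum A (k + 1) H := by
  rw [Finset.sum_congr rfl fun a ha => exchangeSum_erase_add A k hH ha, Finset.sum_comm,
    exchangeSum_succ A k hH, Finset.mul_sum]
  exact Finset.sum_congr rfl fun T _ => sum_sum_erase_erase Finset.sdiff_subset fun i => hH _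

lemma sum_erase_eq_exchangeSum (A : Finset α) (k : ℕ) {H : Finset α → Finset α → ℝ}
    (hH : ∀ S, H S S = 0) :
    ∑ a ∈ A, ∑ T ∈ (A.erase a).powersetCard k, ∑ j ∈ A.erase a \ T,
      H (insert a T) (insert j T) = exchangeSum A (k + 1) H := by
  rw [exchangeSum_succ A k hH,
    Finset.sum_comm' (t' := A.powersetCard k) (s' := fun T => A \ T)]
  · refine Finset.sum_congr rfl fun T _ => Finset.sum_congr rfl fun i _ => ?_
    rw [Finset.erase_sdiff_comm]
    exact Finset.sum_erase _ (hH _)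
  · intro a T
    simp only [Finset.mem_powersetCard, Finset.mem_sdiff, Finset.subset_erase]
    tauto

lemma jeffreys_sum_insert_le {A : Finset α} {a : α} {k : ℕ} (hk : k < A.card)
    {f : Finset α → ℝ} (hf : ∀ S, 0 < f S) :
    jeffreys (((A.card : ℝ) - k) * ∑ T ∈ A.powersetCard k, f (insert a T))
        ((k + 1) * ∑ S ∈ A.powersetCard (k + 1), f S) ≤
      ∑ T ∈ A.powersetCard k, ∑ j ∈ A \ T, jeffreys (f (insert a T)) (f (insert j T)) := by
  have hcard : ∀ T ∈ A.powersetCard k, ((A \ T).card : ℝ) = A.card - k := fun T hT => by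
    obtain ⟨hTA, hTk⟩ := Finset.mem_powersetCard.1 hT
    rw [Finset.cast_card_sdiff hTA, hTk]
  have hleft : ((A.card : ℝ) - k) * ∑ T ∈ A.powersetCard k, f (insert a T) =
      ∑ T ∈ A.powersetCard k, ∑ _j ∈ A \ T, f (insert a T) := by
    rw [Finset.mul_sum]
    exact Finset.sum_congr rfl fun T hT => by rw [Finset.sum_const, nsmul_eq_mul, hcard T hT]
  have hright : ((k : ℝ) + 1) * ∑ S ∈ A.powersetCard (k + 1), f S =
      ∑ T ∈ A.powersetCard k, ∑ j ∈ A \ T, f (insert j T) := by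
    rw [sum_powersetCard_sum_sdiff A k fun S _ => f S, Finset.mul_sum]
    refine Finset.sum_congr rfl fun S hS => ?_
    rw [Finset.sum_const, (Finset.mem_powersetCard.1 hS).2, nsmul_eq_mul, Nat.cast_add_one]
  rw [hleft, hright, Finset.sum_sigma', Finset.sum_sigma', Finset.sum_sigma']
  refine jeffreys_sum_le_sum ?_ (fun _ _ => hf _) fun _ _ => hf _
  obtain ⟨T, hT⟩ := Finset.powersetCard_nonempty.2 hk.le
  obtain ⟨j, hj⟩ : (A \ T).Nonempty := by
    rw [← Finset.card_pos, ← Nat.cast_pos (α := ℝ), hcard T hT, sub_pos]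
    exact_mod_cast hk
  exact ⟨⟨T, j⟩, Finset.mem_sigma.2 ⟨hT, hj⟩⟩

lemma jeffreys_choose_mul {n k : ℕ} (hk : k < n) {a b : ℝ} (ha : a ≠ 0) (hb : b ≠ 0) :
    jeffreys (n.choose k * a) (n.choose (k + 1) * b) / (n.choose (k + 1) + n.choose k) =
      jeffreys ((k + 1) * a) ((n - k) * b) / (n + 1) := by
  have hk' : (k : ℝ) < n := by exact_mod_cast hk
  have hN : (0 : ℝ) < (n + 1).choose (k + 1) := by exact_mod_cast Nat.choose_pos (by omega)
  have hn : (n : ℝ) + 1 ≠ 0 := by positivity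
  have hsum : ((n + 1).choose (k + 1) : ℝ) = n.choose (k + 1) + n.choose k := by
    rw [Nat.choose_succ_succ, Nat.cast_add, add_comm]
  have hlow : (n.choose k : ℝ) = (n + 1).choose (k + 1) / (n + 1) * (k + 1) := by
    have := Nat.add_one_mul_choose_eq n k
    field_simp
    rw [mul_comm]
    exact_mod_cast this
  have hhigh : (n.choose (k + 1) : ℝ) = (n + 1).choose (k + 1) / (n + 1) * (n - k) := by
    have := eq_sub_of_add_eq hsum.symm
    rw [this, hlow]
    field_simp
    ring
  rw [← hsum, hlow, hhigh, mul_assoc, mul_assoc,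
    jeffreys_mul (by positivity) (by positivity) (mul_ne_zero (by linarith) hb)]
  field_simp

lemma finEnt_powersetCard_insert_le {A : Finset α} {a : α} (ha : a ∉ A) {k : ℕ}
    (hk : k < A.card) {f : Finset α → ℝ} (hf : ∀ S, 0 < f S) :
    finEnt ((insert a A).powersetCard (k + 1)) f ≤
      finEnt (A.powersetCard k) (fun T => f (insert a T)) + finEnt (A.powersetCard (k + 1)) f +
        (∑ T ∈ A.powersetCard k, ∑ j ∈ A \ T, jeffreys (f (insert a T)) (f (insert j T))) /
          (A.card + 1) := by
  have hinj := injOn_insert_powersetCard ha k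
  have hne : (A.powersetCard (k + 1)).Nonempty := Finset.powersetCard_nonempty.2 hk
  have hne' : (A.powersetCard k).Nonempty := Finset.powersetCard_nonempty.2 hk.le
  have hunion := finEnt_union_le (disjoint_powersetCard_succ_image_insert ha k) hne
    (hne'.image _) hf
  rw [finEnt_image hinj, Finset.sum_image hinj, Finset.card_image_of_injOn hinj,
    Finset.card_powersetCard, Finset.card_powersetCard,
    jeffreys_choose_mul hk (Finset.sum_pos (fun _ _ => hf _) hne).ne'
      (Finset.sum_pos (fun _ _ => hf _) hne').ne', jeffreys_comm] at hunion
  rw [Finset.powersetCard_succ_insert ha]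
  have hjeffreys := div_le_div_of_nonneg_right (jeffreys_sum_insert_le (a := a) hk hf)
    (by positivity : (0 : ℝ) ≤ A.card + 1)
  simp only [Function.comp_def] at hunion
  linarith

lemma finEnt_powersetCard_le_of_erase {A : Finset α} {a : α} (ha : a ∈ A) {n k : ℕ}
    (hn : A.card = n + 1) (hk : k < n) {f : Finset α → ℝ} (hf : ∀ S, 0 < f S)
    (herase : ∀ l ≤ n, ∀ g : Finset α → ℝ, (∀ S, 0 < g S) →
      n * finEnt ((A.erase a).powersetCard l) g ≤
        exchangeSum (A.erase a) l fun S T => jeffreys (g S) (g T)) :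
    finEnt (A.powersetCard (k + 1)) f ≤
      (exchangeSum (A.erase a) k (fun S T => jeffreys (f (insert a S)) (f (insert a T))) +
        exchangeSum (A.erase a) (k + 1) (fun S T => jeffreys (f S) (f T))) / n +
      (∑ T ∈ (A.erase a).powersetCard k, ∑ j ∈ A.erase a \ T,
        jeffreys (f (insert a T)) (f (insert j T))) / (n + 1) := by
  have hcard : (A.erase a).card = n := by rw [Finset.card_erase_of_mem ha, hn, Nat.add_sub_cancel]
  have hn0 : (0 : ℝ) < n := by exact_mod_cast (by omega : 0 < n)
  have hsplit := finEnt_powersetCard_insert_le (Finset.notMem_erase a A) (hk.trans_eq hcard.symm) hf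
  rw [Finset.insert_erase ha, hcard] at hsplit
  have hmem := herase k hk.le (fun T => f (insert a T)) fun _ => hf _
  have hnotMem := herase (k + 1) hk f hf
  refine hsplit.trans (add_le_add_left ?_ _)
  rw [le_div_iff₀' hn0]
  linarith

theorem card_mul_finEnt_powersetCard_le {A : Finset α} {k : ℕ} (hk : k ≤ A.card)
    {f : Finset α → ℝ} (hf : ∀ S, 0 < f S) :
    A.card * finEnt (A.powersetCard k) f ≤ exchangeSum A k fun S T => jeffreys (f S) (f T) := by
  have hdiag : ∀ (g : Finset α → ℝ) (S), jeffreys (g S) (g S) = 0 := fun g S => jeffreys_self _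
  have hnonneg : 0 ≤ exchangeSum A k fun S T => jeffreys (f S) (f T) :=
    exchangeSum_nonneg A k fun S T => jeffreys_nonneg (hf S) (hf T)
  induction hn : A.card generalizing A k f with
  | zero => simpa using hnonneg
  | succ n ih =>
    by_cases hone : (A.powersetCard k).card = 1
    · simpa only [finEnt_of_card_eq_one hone, mul_zero] using hnonneg
    obtain ⟨k, rfl⟩ : ∃ l, k = l + 1 :=
      Nat.exists_eq_succ_of_ne_zero fun h => hone (by simp [h])
    have hkn : k < n := by
      have : k + 1 ≠ A.card := fun h => hone (by simp [h])
      omega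
    have hn1 : (1 : ℝ) ≤ n := by exact_mod_cast (by omega : 1 ≤ n)
    have hsum := Finset.sum_le_sum fun a ha => finEnt_powersetCard_le_of_erase ha hn hkn hf
      fun l hl g hg => ih (k := l) (by rw [Finset.card_erase_of_mem ha]; omega) hg
        (exchangeSum_nonneg _ _ fun S T => jeffreys_nonneg (hg S) (hg T))
        (by rw [Finset.card_erase_of_mem ha]; omega)
    rw [Finset.sum_const, nsmul_eq_mul, Finset.sum_add_distrib, ← Finset.sum_div,
      ← Finset.sum_div, sum_exchangeSum_erase_add A k (H := fun S T => jeffreys (f S) (f T))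
        (hdiag f), sum_erase_eq_exchangeSum A k (H := fun S T => jeffreys (f S) (f T)) (hdiag f),
      hn] at hsum
    refine hsum.trans ?_
    have hcoeff : ((n : ℝ) + 1 - 2) / n + 1 / (n + 1) ≤ 1 := by
      rw [div_add_div _ _ (by positivity) (by positivity), div_le_one (by positivity)]
      linarith
    calc _ = (((n : ℝ) + 1 - 2) / n + 1 / (n + 1)) *
          exchangeSum A (k + 1) fun S T => jeffreys (f S) (f T) := by push_cast; ring
      _ ≤ _ := mul_le_of_le_one_left hnonneg hcoeff

end Slice

section Herbst

open ProbabilityTheory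

lemma antitoneOn_div_sub_mul_of_mul_deriv_sub_le {φ : ℝ → ℝ} (hφ : Differentiable ℝ φ) {v : ℝ}
    (h : ∀ t, 0 < t → t * deriv φ t - φ t ≤ v * t ^ 2) :
    AntitoneOn (fun t => φ t / t - v * t) (Set.Ioi 0) := by
  have hderiv : ∀ t ∈ Set.Ioi (0 : ℝ), HasDerivAt (fun t => φ t / t - v * t)
      ((deriv φ t * t - φ t * 1) / t ^ 2 - v * 1) t := fun t ht =>
    ((hφ t).hasDerivAt.div (hasDerivAt_id t) (ne_of_gt ht)).sub ((hasDerivAt_id t).const_mul v)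
  refine antitoneOn_of_deriv_nonpos (convex_Ioi 0)
    (fun t ht => (hderiv t ht).continuousAt.continuousWithinAt) ?_ ?_ <;> rw [interior_Ioi]
  · exact fun t ht => (hderiv t ht).differentiableAt.differentiableWithinAt
  · intro t ht
    have ht0 : 0 < t := ht
    rw [(hderiv t ht).deriv, sub_nonpos, div_le_iff₀ (by positivity)]
    linarith [h t ht0]

lemma le_mul_deriv_zero_add_of_mul_deriv_sub_le {φ : ℝ → ℝ} (hφ : Differentiable ℝ φ)
    (hφ0 : φ 0 = 0) {v : ℝ} (h : ∀ t, 0 < t → t * deriv φ t - φ t ≤ v * t ^ 2) {t : ℝ}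
    (ht : 0 ≤ t) : φ t ≤ t * deriv φ 0 + v * t ^ 2 := by
  rcases ht.eq_or_lt with rfl | ht
  · simp [hφ0]
  have hlim : Filter.Tendsto (fun t => φ t / t - v * t) (nhdsWithin 0 (Set.Ioi 0))
      (nhds (deriv φ 0 - v * 0)) := by
    refine Filter.Tendsto.sub ?_
      (((continuous_const.mul continuous_id).tendsto 0).mono_left nhdsWithin_le_nhds)
    refine ((hasDerivAt_iff_tendsto_slope.1 (hφ 0).hasDerivAt).mono_left
      (nhdsWithin_mono _ fun t ht => ne_of_gt ht)).congr fun t => ?_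
    simp [slope_def_field, hφ0]
  have hle : φ t / t - v * t ≤ deriv φ 0 - v * 0 := by
    refine ge_of_tendsto hlim ?_
    filter_upwards [Ioo_mem_nhdsGT ht] with s hs
    exact antitoneOn_div_sub_mul_of_mul_deriv_sub_le hφ h hs.1 ht hs.2.le
  have hdiv : φ t / t ≤ deriv φ 0 + v * t := by linarith
  rw [div_le_iff₀ ht] at hdiv
  linarith

variable {Ω : Type*} [MeasurableSpace Ω] {μ : Measure Ω} [IsProbabilityMeasure μ] {X : Ω → ℝ}
  {v : ℝ}

lemma cgf_le_of_entropy_le (hX : integrableExpSet X μ = Set.univ)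
    (hent : ∀ t, 0 < t → t * ∫ ω, X ω * Real.exp (t * X ω) ∂μ -
      mgf X μ t * cgf X μ t ≤
        v * t ^ 2 * mgf X μ t) {t : ℝ} (ht : 0 ≤ t) :
    cgf X μ t ≤ t * ∫ ω, X ω ∂μ + v * t ^ 2 := by
  have hint : ∀ t, t ∈ interior (integrableExpSet X μ) := by simp [hX]
  have hmgf : ∀ t, 0 < mgf X μ t := fun t =>
    mgf_pos (show t ∈ integrableExpSet X μ from hX ▸ Set.mem_univ t)
  have hderiv0 : deriv (cgf X μ) 0 = ∫ ω, X ω ∂μ := by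
    rw [deriv_cgf_zero (hint 0), probReal_univ, div_one]
  rw [← hderiv0]
  refine le_mul_deriv_zero_add_of_mul_deriv_sub_le
    (fun t => (analyticAt_cgf (hint t)).differentiableAt)
    cgf_zero (fun t ht => ?_) ht
  rw [deriv_cgf (hint t), ← mul_div_assoc, sub_le_iff_le_add,
    div_le_iff₀ (hmgf t)]
  linarith [hent t ht]

theorem measureReal_integral_add_sqrt_le_of_entropy_le
    (hX : integrableExpSet X μ = Set.univ) (hv : 0 < v)
    (hent : ∀ t, 0 < t → t * ∫ ω, X ω * Real.exp (t * X ω) ∂μ -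
      mgf X μ t * cgf X μ t ≤
        v * t ^ 2 * mgf X μ t) {x : ℝ} (hx : 0 ≤ x) :
    μ.real {ω | ∫ ω, X ω ∂μ + 2 * √(v * x) ≤ X ω} ≤ Real.exp (-x) := by
  set t := √(x / v)
  have ht : 0 ≤ t := Real.sqrt_nonneg _
  have ht_mul : t * √(v * x) = x := by
    rw [← Real.sqrt_mul (by positivity), show x / v * (v * x) = x ^ 2 by field_simp,
      Real.sqrt_sq hx]
  have ht_sq : v * t ^ 2 = x := by
    rw [Real.sq_sqrt (by positivity)]
    field_simp
  refine (measure_ge_le_exp_cgf _ ht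
    (show t ∈ integrableExpSet X μ from hX ▸ Set.mem_univ t)).trans ?_
  refine Real.exp_le_exp.2 ?_
  linarith [cgf_le_of_entropy_le hX hent ht, mul_add t (∫ ω, X ω ∂μ) (2 * √(v * x))]

end Herbst

section SamplingConcentration

/-- The sum of `(Y S - Y S')₊²` over the sets `S'` obtained from `S` by exchanging one element:
the one-sided discrete gradient of `Y` for sampling without replacement. -/
noncomputable def upVar {α : Type*} [Fintype α] [DecidableEq α] (Y : Finset α → ℝ)
    (S : Finset α) : ℝ :=
  ∑ i ∈ S, ∑ j ∈ Sᶜ, (max (Y S - Y (insert j (S.erase i))) 0) ^ 2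

lemma upVar_const_mul {α : Type*} [Fintype α] [DecidableEq α] {c : ℝ} (hc : 0 ≤ c)
    (Y : Finset α → ℝ) (S : Finset α) : upVar (fun S => c * Y S) S = c ^ 2 * upVar Y S := by
  simp only [upVar, Finset.mul_sum]
  refine Finset.sum_congr rfl fun i _ => Finset.sum_congr rfl fun j _ => ?_
  rw [← mul_sub, ← mul_pow, mul_max_of_nonneg _ _ hc, mul_zero]

lemma exchangeSum_jeffreys_exp_le {α : Type*} [Fintype α] [DecidableEq α] (k : ℕ)
    (Y : Finset α → ℝ) :
    exchangeSum Finset.univ k (fun S T => jeffreys (Real.exp (Y S)) (Real.exp (Y T))) ≤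
      2 * ∑ S ∈ Finset.univ.powersetCard k, Real.exp (Y S) * upVar Y S := by
  set H : Finset α → Finset α → ℝ := fun S T => Real.exp (Y S) * (max (Y S - Y T) 0) ^ 2
  have hsum : exchangeSum Finset.univ k H =
      ∑ S ∈ Finset.univ.powersetCard k, Real.exp (Y S) * upVar Y S := by
    simp only [exchangeSum, upVar, Finset.mul_sum, Finset.compl_eq_univ_sdiff, H]
  have hadd : exchangeSum Finset.univ k (fun S T => H S T + H T S) =
      exchangeSum Finset.univ k H + exchangeSum Finset.univ k (fun S T => H T S) := by
    simp only [exchangeSum, Finset.sum_add_distrib]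
  calc exchangeSum Finset.univ k (fun S T => jeffreys (Real.exp (Y S)) (Real.exp (Y T)))
    _ ≤ exchangeSum Finset.univ k (fun S T => H S T + H T S) :=
        Finset.sum_le_sum fun _ _ => Finset.sum_le_sum fun _ _ => Finset.sum_le_sum fun _ _ =>
          jeffreys_exp_le _ _
    _ = 2 * exchangeSum Finset.univ k H := by
        rw [hadd, exchangeSum_comm _ k (H := H) fun S => by simp [H], two_mul]
    _ = 2 * ∑ S ∈ Finset.univ.powersetCard k, Real.exp (Y S) * upVar Y S := by rw [hsum]

lemma card_mul_finEnt_exp_le {α : Type*} [Fintype α] [DecidableEq α] {k : ℕ}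
    (hk : k ≤ Fintype.card α) {Y : Finset α → ℝ} {v : ℝ}
    (h : ∀ S : Finset α, S.card = k → 2 * upVar Y S ≤ v) :
    Fintype.card α * finEnt (Finset.univ.powersetCard k) (fun S => Real.exp (Y S)) ≤
      v * ∑ S ∈ Finset.univ.powersetCard k, Real.exp (Y S) := by
  refine (card_mul_finEnt_powersetCard_le (A := Finset.univ) hk fun _ => Real.exp_pos _).trans
    ((exchangeSum_jeffreys_exp_le k Y).trans ?_)
  rw [Finset.mul_sum, Finset.mul_sum]
  refine Finset.sum_le_sum fun S hS => ?_
  linarith [mul_le_mul_of_nonneg_left (h S (Finset.mem_powersetCard.1 hS).2)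
    (Real.exp_pos (Y S)).le]

variable {m u : ℕ}

lemma finEnt_exp_div_choose (Y : Finset (Fin (m + u)) → ℝ) (t : ℝ) :
    finEnt (Finset.univ.powersetCard u) (fun T => Real.exp (t * Y T)) / (m + u).choose u =
      t * ∫ d, Y (testSet d) * Real.exp (t * Y (testSet d)) ∂(drawLaw m u) -
        ProbabilityTheory.mgf (fun d => Y (testSet d)) (drawLaw m u) t *
          ProbabilityTheory.cgf (fun d => Y (testSet d)) (drawLaw m u) t := by
  rw [ProbabilityTheory.cgf, ProbabilityTheory.mgf,
    integral_testSet fun T => Real.exp (t * Y T),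
    integral_testSet fun T => Y T * Real.exp (t * Y T)]
  simp only [finEnt, Real.log_exp, Finset.card_powersetCard, Finset.card_univ, Fintype.card_fin]
  rw [sub_div, ← mul_div_assoc, Finset.mul_sum, div_mul_eq_mul_div]
  congr 3 with T
  ring

theorem drawLaw_integral_add_sqrt_le_of_upVar_le (hn : 0 < m + u) {Y : Finset (Fin (m + u)) → ℝ}
    {v : ℝ} (hv : 0 < v) (h : ∀ T, T.card = u → 2 * upVar Y T ≤ v * (m + u : ℕ)) {x : ℝ}
    (hx : 0 ≤ x) :
    (drawLaw m u).real {d | ∫ d, Y (testSet d) ∂(drawLaw m u) + 2 * √(v * x) ≤ Y (testSet d)} ≤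
      Real.exp (-x) := by
  refine measureReal_integral_add_sqrt_le_of_entropy_le (X := fun d => Y (testSet d))
    (Set.eq_univ_of_forall fun t => Integrable.of_finite) hv (fun t ht => ?_) hx
  have hn' : (0 : ℝ) < (m + u : ℕ) := by exact_mod_cast hn
  have hN : (0 : ℝ) < (m + u).choose u := by
    exact_mod_cast Nat.choose_pos (Nat.le_add_left u m)
  have hent := card_mul_finEnt_exp_le (k := u) (by simp) (Y := fun T => t * Y T)
    (v := (m + u : ℕ) * (v * t ^ 2)) fun T hT => by
      rw [upVar_const_mul ht.le]
      linarith [mul_le_mul_of_nonneg_left (h T hT) (sq_nonneg t)]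
  rw [Fintype.card_fin, mul_assoc, mul_le_mul_iff_of_pos_left hn'] at hent
  rw [← finEnt_exp_div_choose, ProbabilityTheory.mgf, integral_testSet fun T => Real.exp (t * Y T),
    ← mul_div_assoc]
  exact div_le_div_of_nonneg_right hent hN.le

lemma max_sqrt_sub_sqrt_sq_le {a b : ℝ} (ha : 0 < a) (hb : 0 ≤ b) :
    (max (√a - √b) 0) ^ 2 ≤ (max (a - b) 0) ^ 2 / a := by
  rcases le_total a b with hab | hab
  · rw [max_eq_right (sub_nonpos.2 (Real.sqrt_le_sqrt hab)), zero_pow two_ne_zero]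
    positivity
  · have hsub : 0 ≤ √a - √b := sub_nonneg.2 (Real.sqrt_le_sqrt hab)
    rw [max_eq_left hsub, max_eq_left (sub_nonneg.2 hab), le_div_iff₀ ha]
    calc (√a - √b) ^ 2 * a = ((√a - √b) * √a) ^ 2 := by rw [mul_pow, Real.sq_sqrt ha.le]
      _ ≤ ((√a - √b) * (√a + √b)) ^ 2 := by
        gcongr
        exact le_add_of_nonneg_right (Real.sqrt_nonneg b)
      _ = (a - b) ^ 2 := by
        rw [mul_comm, ← sq_sub_sq, Real.sq_sqrt ha.le, Real.sq_sqrt hb]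

lemma upVar_sqrt_le {α : Type*} [Fintype α] [DecidableEq α] {G : Finset α → ℝ}
    (hG : ∀ S, 0 < G S) (S : Finset α) : upVar (fun S => √(G S)) S ≤ upVar G S / G S := by
  simp only [upVar, Finset.sum_div]
  exact Finset.sum_le_sum fun i _ => Finset.sum_le_sum fun j _ =>
    max_sqrt_sub_sqrt_sq_le (hG _) (hG _).le

lemma add_sq_le_mul_sq_add {ε : ℝ} (hε : 0 < ε) (hε1 : ε ≤ 1) (a b : ℝ) :
    (a + b) ^ 2 ≤ (1 + ε) * a ^ 2 + 2 / ε * b ^ 2 := by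
  have hone : 1 ≤ 1 / ε := (one_le_div hε).2 hε1
  have hsq : 0 ≤ (ε * a - b) ^ 2 / ε := by positivity
  have hexpand : (ε * a - b) ^ 2 / ε = ε * a ^ 2 - 2 * a * b + 1 / ε * b ^ 2 := by
    field_simp
    ring
  have htwo : 2 / ε * b ^ 2 = 1 / ε * b ^ 2 + 1 / ε * b ^ 2 := by ring
  nlinarith [mul_le_mul_of_nonneg_right hone (sq_nonneg b)]

lemma sq_integral_le_integral_sq {Ω : Type*} [MeasurableSpace Ω] {μ : Measure Ω}
    [IsProbabilityMeasure μ] {X : Ω → ℝ} (hX : MemLp X 2 μ) :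
    (∫ ω, X ω ∂μ) ^ 2 ≤ ∫ ω, X ω ^ 2 ∂μ := by
  have hvar := ProbabilityTheory.variance_nonneg X μ
  rw [ProbabilityTheory.variance_eq_sub hX] at hvar
  exact sub_nonneg.1 hvar

-- Since `G` controls its own discrete gradient, `√G` has a bounded one.
theorem drawLaw_mul_integral_add_le_of_selfBounding (hn : 0 < m + u)
    {G : Finset (Fin (m + u)) → ℝ} (hG : ∀ T, 0 < G T) {v : ℝ} (hv : 0 < v)
    (h : ∀ T, T.card = u → 2 * upVar G T ≤ v * (m + u : ℕ) * G T) {ε x : ℝ} (hε : 0 < ε)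
    (hε1 : ε ≤ 1) (hx : 0 ≤ x) :
    (drawLaw m u).real
        {d | (1 + ε) * ∫ d, G (testSet d) ∂(drawLaw m u) + 8 * v * x / ε ≤ G (testSet d)} ≤
      Real.exp (-x) := by
  have hroot := drawLaw_integral_add_sqrt_le_of_upVar_le hn (Y := fun T => √(G T)) hv
    (fun T hT => by
      have := mul_le_mul_of_nonneg_left (upVar_sqrt_le hG T) zero_le_two
      rw [← mul_div_assoc] at this
      exact this.trans ((div_le_iff₀ (hG T)).2 (h T hT))) hx
  refine (measureReal_mono fun d hd => ?_).trans hroot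
  simp only [Set.mem_ofPred_eq] at hd ⊢
  refine Real.le_sqrt_of_sq_le (le_trans ?_ hd)
  refine (add_sq_le_mul_sq_add hε hε1 _ _).trans (add_le_add ?_ (le_of_eq ?_))
  · refine mul_le_mul_of_nonneg_left ?_ (by linarith)
    simpa only [Real.sq_sqrt (hG _).le] using sq_integral_le_integral_sq
      (μ := drawLaw m u) (X := fun d => √(G (testSet d))) .of_discrete
  · rw [mul_pow, Real.sq_sqrt (by positivity)]
    ring

end SamplingConcentration

section Talagrand

open Finset (univ)

variable {α : Type*} [Fintype α]

/-- The sum over `T` of the deviations of `q` from its average over all of `α`. -/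
noncomputable def centeredSum (q : α → ℝ) (T : Finset α) : ℝ :=
  ∑ i ∈ T, (q i - (∑ j, q j) / Fintype.card α)

lemma centeredSum_eq_sum_sub (q : α → ℝ) (T : Finset α) :
    centeredSum q T = ∑ i ∈ T, q i - T.card * ((∑ j, q j) / Fintype.card α) := by
  rw [centeredSum, Finset.sum_sub_distrib, Finset.sum_const, nsmul_eq_mul]

lemma centeredSum_zero (T : Finset α) : centeredSum (0 : α → ℝ) T = 0 := by
  simp [centeredSum]

lemma centeredSum_const_mul (c : ℝ) (q : α → ℝ) (T : Finset α) :
    centeredSum (fun i => c * q i) T = c * centeredSum q T := by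
  simp only [centeredSum, ← Finset.mul_sum, mul_div_assoc, ← mul_sub]

lemma continuous_centeredSum (T : Finset α) : Continuous fun q : α → ℝ => centeredSum q T := by
  unfold centeredSum
  fun_prop

lemma sum_le_centeredSum_add {q : α → ℝ} {r : ℝ} (hq : ∑ i, q i ≤ Fintype.card α * r)
    (T : Finset α) : ∑ i ∈ T, q i ≤ centeredSum q T + T.card * r := by
  rcases isEmpty_or_nonempty α with _ | _
  · simp [centeredSum, Subsingleton.elim T ∅]
  · have hmean : (∑ j, q j) / Fintype.card α ≤ r :=
      (div_le_iff₀' (by exact_mod_cast Fintype.card_pos)).2 hq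
    rw [centeredSum_eq_sum_sub]
    linarith [mul_le_mul_of_nonneg_left hmean (Nat.cast_nonneg T.card)]

/-- The largest deviation `centeredSum q T` of a function `q` of the class `K`. -/
noncomputable def supDev (K : Set (α → ℝ)) (T : Finset α) : ℝ :=
  sSup ((fun q => centeredSum q T) '' K)

/-- A class of functions that contains `0`, is bounded by `L`, and whose members have mean square
at most `r`. -/
structure IsLocalizedClass (K : Set (α → ℝ)) (L r : ℝ) : Prop where
  zero_mem : 0 ∈ K
  abs_le : ∀ q ∈ K, ∀ i, |q i| ≤ L
  sum_sq_le : ∀ q ∈ K, ∑ i, q i ^ 2 ≤ Fintype.card α * r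

namespace IsLocalizedClass

variable {K : Set (α → ℝ)} {L r : ℝ}

protected lemma closure (hK : IsLocalizedClass K L r) : IsLocalizedClass (closure K) L r where
  zero_mem := subset_closure hK.zero_mem
  abs_le q hq i := closure_minimal (t := {q : α → ℝ | |q i| ≤ L}) (fun q hq => hK.abs_le q hq i)
    (isClosed_le (by fun_prop) continuous_const) hq
  sum_sq_le q hq := closure_minimal (t := {q : α → ℝ | ∑ i, q i ^ 2 ≤ Fintype.card α * r})
    hK.sum_sq_le (isClosed_le (by fun_prop) continuous_const) hq

lemma isCompact_closure (hK : IsLocalizedClass K L r) : IsCompact (closure K) := by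
  refine Metric.isCompact_of_isClosed_isBounded isClosed_closure
    (Metric.isBounded_closedBall (x := 0) (r := |L|) |>.subset fun q hq => ?_)
  rw [mem_closedBall_zero_iff, pi_norm_le_iff_of_nonneg (abs_nonneg L)]
  exact fun i => (hK.closure.abs_le q hq i).trans (le_abs_self L)

lemma exists_mem_closure_isMaxOn (hK : IsLocalizedClass K L r) {φ : (α → ℝ) → ℝ}
    (hφ : Continuous φ) : ∃ g ∈ closure K, φ g = sSup (φ '' K) ∧
      ∀ q ∈ closure K, φ q ≤ sSup (φ '' K) := by
  obtain ⟨g, hg, hmax⟩ := hK.isCompact_closure.exists_isMaxOn ⟨0, hK.closure.zero_mem⟩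
    hφ.continuousOn
  have hbdd : BddAbove (φ '' K) := ⟨φ g, by
    rintro _ ⟨q, hq, rfl⟩
    exact hmax (subset_closure hq)⟩
  have hle : ∀ q ∈ closure K, φ q ≤ sSup (φ '' K) :=
    fun q hq => closure_minimal (t := {q | φ q ≤ sSup (φ '' K)})
      (fun q hq => le_csSup hbdd ⟨q, hq, rfl⟩) (isClosed_le hφ continuous_const) hq
  refine ⟨g, hg, (hle g hg).antisymm (csSup_le ⟨φ 0, 0, hK.zero_mem, rfl⟩ ?_), hle⟩
  rintro _ ⟨q, hq, rfl⟩
  exact hmax (subset_closure hq)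

lemma centeredSum_le_supDev (hK : IsLocalizedClass K L r) {q : α → ℝ} (hq : q ∈ closure K)
    (T : Finset α) : centeredSum q T ≤ supDev K T := by
  obtain ⟨_, _, _, hle⟩ := hK.exists_mem_closure_isMaxOn (continuous_centeredSum T)
  exact hle q hq

lemma supDev_nonneg (hK : IsLocalizedClass K L r) (T : Finset α) : 0 ≤ supDev K T :=
  (centeredSum_zero T).ge.trans (hK.centeredSum_le_supDev (subset_closure hK.zero_mem) T)

end IsLocalizedClass

variable [DecidableEq α]

lemma centeredSum_compl (q : α → ℝ) (T : Finset α) :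
    centeredSum q Tᶜ = -centeredSum q T := by
  rw [eq_neg_iff_add_eq_zero, add_comm, centeredSum, centeredSum, Finset.sum_add_sum_compl,
    Finset.sum_sub_distrib, Finset.sum_const, nsmul_eq_mul, Finset.card_univ]
  rcases isEmpty_or_nonempty α with _ | _
  · simp
  · rw [mul_div_cancel₀ _ (by exact_mod_cast Fintype.card_ne_zero), sub_self]

lemma centeredSum_sub_exchange (q : α → ℝ) {T : Finset α} {i j : α} (hi : i ∈ T) (hj : j ∉ T) :
    centeredSum q T - centeredSum q (insert j (T.erase i)) = q i - q j := by
  rw [centeredSum, centeredSum, Finset.sum_insert fun h => hj (Finset.mem_of_mem_erase h),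
    ← Finset.add_sum_erase T _ hi]
  ring

/-- The smaller of `T` and its complement, on which the deviations of squares are measured. -/
def smallPart (T : Finset α) : Finset α :=
  if T.card ≤ Tᶜ.card then T else Tᶜ

lemma card_smallPart (T : Finset α) : (smallPart T).card = min T.card Tᶜ.card := by
  unfold smallPart
  split_ifs with h
  · exact (min_eq_left h).symm
  · exact (min_eq_right (not_le.1 h).le).symm

/-- The largest deviation, on the smaller of `T` and `Tᶜ`, of the square of a function of the
class `K`. -/
noncomputable def supSqDev (K : Set (α → ℝ)) (T : Finset α) : ℝ :=
  sSup ((fun q => centeredSum (q ^ 2) (smallPart T)) '' K)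

lemma max_add_sq_sub_sq_le {c L : ℝ} (hc : |c| ≤ L) (x d : ℝ) :
    (max (x + (c ^ 2 - d ^ 2)) 0) ^ 2 ≤ 2 * x ^ 2 + 2 * L ^ 2 * c ^ 2 := by
  have hmax : max (x + (c ^ 2 - d ^ 2)) 0 ≤ |x| + c ^ 2 :=
    max_le (by linarith [le_abs_self x, sq_nonneg d]) (by positivity)
  have hcL : c ^ 2 * c ^ 2 ≤ L ^ 2 * c ^ 2 :=
    mul_le_mul_of_nonneg_right (sq_le_sq.2 (hc.trans (le_abs_self L))) (sq_nonneg c)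
  calc (max (x + (c ^ 2 - d ^ 2)) 0) ^ 2 ≤ (|x| + c ^ 2) ^ 2 :=
        pow_le_pow_left₀ (le_max_right _ _) hmax 2
    _ ≤ 2 * (|x| ^ 2 + (c ^ 2) ^ 2) := add_sq_le
    _ ≤ 2 * x ^ 2 + 2 * L ^ 2 * c ^ 2 := by rw [sq_abs]; linarith

lemma centeredSum_smallPart_sub_exchange (q : α → ℝ) {T : Finset α} {i j : α} (hi : i ∈ T)
    (hj : j ∉ T) : centeredSum q (smallPart T) - centeredSum q (smallPart (insert j (T.erase i))) =
      if T.card ≤ Tᶜ.card then q i - q j else q j - q i := by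
  have hcard : (insert j (T.erase i)).card = T.card := by
    rw [Finset.card_insert_of_notMem fun h => hj (Finset.mem_of_mem_erase h),
      Finset.card_erase_add_one hi]
  simp only [smallPart, Finset.card_compl, hcard]
  split_ifs
  · exact centeredSum_sub_exchange q hi hj
  · rw [centeredSum_compl, centeredSum_compl, neg_sub_neg, ← neg_sub,
      centeredSum_sub_exchange q hi hj, neg_sub]

lemma sum_sum_compl_smallPart (T : Finset α) (f : α → α → ℝ) :
    ∑ a ∈ smallPart T, ∑ b ∈ (smallPart T)ᶜ, f a b =
      ∑ i ∈ T, ∑ j ∈ Tᶜ, if T.card ≤ Tᶜ.card then f i j else f j i := by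
  unfold smallPart
  split_ifs
  · rfl
  · rw [compl_compl, Finset.sum_comm]

lemma sum_sum_compl_sq_le (A : Finset α) (g w : α → ℝ) (L : ℝ) {V : ℝ}
    (hg : ∑ a ∈ A, g a ^ 2 ≤ V) (hw : ∑ a ∈ A, w a ^ 2 ≤ V)
    (hsum : A.card * ∑ i, g i ^ 2 ≤ Fintype.card α * V) :
    ∑ a ∈ A, ∑ b ∈ Aᶜ, (4 * g a ^ 2 + 4 * g b ^ 2 + 2 * L ^ 2 * w a ^ 2) ≤
      (8 + 2 * L ^ 2) * Fintype.card α * V := by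
  have hcompl : (Aᶜ.card : ℝ) ≤ Fintype.card α := by exact_mod_cast Finset.card_le_univ Aᶜ
  have hsub : ∑ b ∈ Aᶜ, g b ^ 2 ≤ ∑ i, g i ^ 2 :=
    Finset.sum_le_univ_sum_of_nonneg fun _ => sq_nonneg _
  have hexpand : ∑ a ∈ A, ∑ b ∈ Aᶜ, (4 * g a ^ 2 + 4 * g b ^ 2 + 2 * L ^ 2 * w a ^ 2) =
      4 * (Aᶜ.card * ∑ a ∈ A, g a ^ 2) + 4 * (A.card * ∑ b ∈ Aᶜ, g b ^ 2) +
        2 * L ^ 2 * (Aᶜ.card * ∑ a ∈ A, w a ^ 2) := by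
    simp only [Finset.sum_add_distrib, Finset.sum_const, nsmul_eq_mul, ← Finset.mul_sum]
    ring
  have hgA : Aᶜ.card * ∑ a ∈ A, g a ^ 2 ≤ Fintype.card α * V := by gcongr
  have hgAc : A.card * ∑ b ∈ Aᶜ, g b ^ 2 ≤ Fintype.card α * V :=
    (mul_le_mul_of_nonneg_left hsub (Nat.cast_nonneg _)).trans hsum
  have hwA : Aᶜ.card * ∑ a ∈ A, w a ^ 2 ≤ Fintype.card α * V := by gcongr
  rw [hexpand]
  linarith [mul_le_mul_of_nonneg_left hwA (show 0 ≤ 2 * L ^ 2 by positivity)]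

namespace IsLocalizedClass

variable {K : Set (α → ℝ)} {L r : ℝ}

lemma centeredSum_sq_le_supSqDev (hK : IsLocalizedClass K L r) {q : α → ℝ} (hq : q ∈ closure K)
    (T : Finset α) : centeredSum (q ^ 2) (smallPart T) ≤ supSqDev K T := by
  obtain ⟨_, _, _, hle⟩ := hK.exists_mem_closure_isMaxOn
    ((continuous_centeredSum (smallPart T)).comp (continuous_pow 2))
  exact hle q hq

lemma supSqDev_nonneg (hK : IsLocalizedClass K L r) (T : Finset α) : 0 ≤ supSqDev K T := by
  have h := hK.centeredSum_sq_le_supSqDev (subset_closure hK.zero_mem) T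
  rwa [zero_pow two_ne_zero, centeredSum_zero] at h

lemma exists_upVar_le (hK : IsLocalizedClass K L r) (T : Finset α) :
    ∃ g ∈ closure K, ∃ w ∈ closure K, upVar (fun T => supDev K T + supSqDev K T) T ≤
      ∑ a ∈ smallPart T, ∑ b ∈ (smallPart T)ᶜ,
        (4 * g a ^ 2 + 4 * g b ^ 2 + 2 * L ^ 2 * w a ^ 2) := by
  obtain ⟨g, hg, hgT, -⟩ := hK.exists_mem_closure_isMaxOn (continuous_centeredSum T)
  obtain ⟨w, hw, hwT, -⟩ := hK.exists_mem_closure_isMaxOn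
    ((continuous_centeredSum (smallPart T)).comp (continuous_pow 2))
  refine ⟨g, hg, w, hw, ?_⟩
  rw [sum_sum_compl_smallPart, upVar]
  refine Finset.sum_le_sum fun i hi => Finset.sum_le_sum fun j hj => ?_
  have hj' : j ∉ T := Finset.mem_compl.1 hj
  have hdiff : supDev K T + supSqDev K T -
      (supDev K (insert j (T.erase i)) + supSqDev K (insert j (T.erase i))) ≤
      g i - g j + if T.card ≤ Tᶜ.card then w i ^ 2 - w j ^ 2 else w j ^ 2 - w i ^ 2 := by
    have hgdiff := centeredSum_sub_exchange g hi hj'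
    have hwdiff := centeredSum_smallPart_sub_exchange (w ^ 2) hi hj'
    simp only [Pi.pow_apply] at hwdiff
    rw [← hwdiff, ← hgdiff]
    have hdev : supDev K T = centeredSum g T := hgT.symm
    have hsq : supSqDev K T = centeredSum (w ^ 2) (smallPart T) := hwT.symm
    linarith [hK.centeredSum_le_supDev hg (insert j (T.erase i)),
      hK.centeredSum_sq_le_supSqDev hw (insert j (T.erase i))]
  refine (pow_le_pow_left₀ (le_max_right _ _) (max_le_max_right 0 hdiff) 2).trans ?_
  have hgsq : (g i - g j) ^ 2 ≤ 2 * (g i ^ 2 + g j ^ 2) := by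
    simpa only [sub_eq_add_neg, neg_sq] using add_sq_le (a := g i) (b := -g j)
  split_ifs
  · linarith [max_add_sq_sub_sq_le (hK.closure.abs_le w hw i) (g i - g j) (w j)]
  · linarith [max_add_sq_sub_sq_le (hK.closure.abs_le w hw j) (g i - g j) (w i)]

lemma two_mul_upVar_le (hK : IsLocalizedClass K L r) (T : Finset α) :
    2 * upVar (fun T => supDev K T + supSqDev K T) T ≤
      (16 + 4 * L ^ 2) * Fintype.card α *
        (supDev K T + supSqDev K T + (smallPart T).card * r) := by
  obtain ⟨g, hg, w, hw, hle⟩ := hK.exists_upVar_le T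
  have hsq : ∀ q ∈ closure K, ∑ i ∈ smallPart T, q i ^ 2 ≤
      supSqDev K T + (smallPart T).card * r := fun q hq =>
    (sum_le_centeredSum_add (hK.closure.sum_sq_le q hq) _).trans
      (add_le_add_left (hK.centeredSum_sq_le_supSqDev hq T) _)
  have hsum : (smallPart T).card * ∑ i, g i ^ 2 ≤
      Fintype.card α * (supSqDev K T + (smallPart T).card * r) := by
    have hg2 := mul_le_mul_of_nonneg_left (hK.closure.sum_sq_le g hg)
      (Nat.cast_nonneg (smallPart T).card)
    linarith [mul_nonneg (Nat.cast_nonneg (α := ℝ) (Fintype.card α)) (hK.supSqDev_nonneg T)]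
  have hdev : 0 ≤ (16 + 4 * L ^ 2) * Fintype.card α * supDev K T :=
    mul_nonneg (by positivity) (hK.supDev_nonneg T)
  linarith [hle.trans (sum_sum_compl_sq_le _ g w L (hsq g hg) (hsq w hw) hsum)]

variable {m u : ℕ} {K : Set (Fin (m + u) → ℝ)}

theorem drawLaw_supDev_ge_le (hK : IsLocalizedClass K L r) (hm : 0 < m) (hu : 0 < u) (hr : 0 < r)
    {ε y : ℝ} (hε : 0 < ε) (hε1 : ε ≤ 1) (hy : 0 ≤ y) :
    (drawLaw m u).real {d |
        2 * (∫ d, supDev K (testSet d) ∂(drawLaw m u) +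
          ∫ d, supSqDev K (testSet d) ∂(drawLaw m u)) +
          ε * (min u m : ℕ) * r + 8 * (16 + 4 * L ^ 2) * y / ε ≤ supDev K (testSet d)} ≤
      Real.exp (-y) := by
  set c : ℝ := (min u m : ℕ) * r
  have hc : 0 < c := mul_pos (by exact_mod_cast lt_min hu hm) hr
  have hG : ∀ T, 0 < supDev K T + supSqDev K T + c := fun T =>
    add_pos_of_nonneg_of_pos (add_nonneg (hK.supDev_nonneg T) (hK.supSqDev_nonneg T)) hc
  refine (measureReal_mono fun d hd => ?_).trans
    (drawLaw_mul_integral_add_le_of_selfBounding (m := m) (u := u) (by omega) hG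
    (v := 16 + 4 * L ^ 2) (by positivity) (fun T hT => ?_) hε hε1 hy)
  · rw [integral_add .of_finite .of_finite, integral_add .of_finite .of_finite, integral_const,
      probReal_univ, one_smul]
    rw [Set.mem_ofPred_eq] at hd ⊢
    have hZ : 0 ≤ ∫ d, supDev K (testSet d) ∂(drawLaw m u) :=
      integral_nonneg fun d => hK.supDev_nonneg _
    have hW : 0 ≤ ∫ d, supSqDev K (testSet d) ∂(drawLaw m u) :=
      integral_nonneg fun d => hK.supSqDev_nonneg _
    rw [mul_assoc ε] at hd
    linarith [mul_le_mul_of_nonneg_right hε1 (add_nonneg hZ hW), hK.supSqDev_nonneg (testSet d)]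
  · have hcard : (smallPart T).card = min u m := by
      rw [card_smallPart, hT, Finset.card_compl, hT, Fintype.card_fin, Nat.add_sub_cancel]
    have h := hK.two_mul_upVar_le T
    rw [hcard, Fintype.card_fin] at h
    simpa only [upVar, add_sub_add_right_eq_sub] using h

end IsLocalizedClass

end Talagrand

section SubRoot

lemma exists_mem_Icc_eq_of_monotoneOn {β : Type*} [ConditionallyCompleteLattice β] {f : β → β}
    {a b : β} (hab : a ≤ b) (hf : MonotoneOn f (Set.Icc a b)) (ha : a ≤ f a) (hb : f b ≤ b) :
    ∃ c ∈ Set.Icc a b, f c = c := by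
  set A : Set β := {s | s ∈ Set.Icc a b ∧ s ≤ f s}
  have haA : a ∈ A := ⟨Set.left_mem_Icc.2 hab, ha⟩
  have hbdd : BddAbove A := ⟨b, fun s hs => hs.1.2⟩
  have hc : sSup A ∈ Set.Icc a b := ⟨le_csSup hbdd haA, csSup_le ⟨a, haA⟩ fun s hs => hs.1.2⟩
  have hle : sSup A ≤ f (sSup A) := csSup_le ⟨a, haA⟩ fun s hs =>
    hs.2.trans (hf hs.1 hc (le_csSup hbdd hs))
  have hfc : f (sSup A) ∈ Set.Icc a b :=
    ⟨hc.1.trans hle, (hf hc (Set.right_mem_Icc.2 hab) hc.2).trans hb⟩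
  exact ⟨_, hc, (le_csSup hbdd ⟨hfc, hf hc hfc hle⟩).antisymm hle⟩

namespace IsSubRoot

variable {ψ : ℝ → ℝ} {rstar r : ℝ}

lemma exists_pos_fixedPoint (hψ : IsSubRoot ψ) (hr : 0 < r) (hpos : 0 < ψ r) :
    ∃ s, 0 < s ∧ ψ s = s := by
  set q := ψ r / √r
  have hq : 0 < q := div_pos hpos (Real.sqrt_pos.2 hr)
  have ha : 0 < min r (q ^ 2) := lt_min hr (by positivity)
  have hb : 0 < max r (q ^ 2) := hr.trans_le (le_max_left _ _)
  have hlow : min r (q ^ 2) ≤ ψ (min r (q ^ 2)) :=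
    calc min r (q ^ 2) = √(min r (q ^ 2)) * √(min r (q ^ 2)) := (Real.mul_self_sqrt ha.le).symm
      _ ≤ q * √(min r (q ^ 2)) := by
        gcongr
        exact (Real.sqrt_le_left hq.le).2 (min_le_right _ _)
      _ ≤ ψ (min r (q ^ 2)) :=
        (le_div_iff₀ (Real.sqrt_pos.2 ha)).1 (hψ.anti ha hr (min_le_left _ _))
  have hup : ψ (max r (q ^ 2)) ≤ max r (q ^ 2) :=
    calc ψ (max r (q ^ 2)) ≤ q * √(max r (q ^ 2)) :=
          (div_le_iff₀ (Real.sqrt_pos.2 hb)).1 (hψ.anti hr hb (le_max_left _ _))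
      _ ≤ √(max r (q ^ 2)) * √(max r (q ^ 2)) := by
        gcongr
        exact Real.le_sqrt_of_sq_le (le_max_right _ _)
      _ = max r (q ^ 2) := Real.mul_self_sqrt hb.le
  obtain ⟨s, hs, hfix⟩ := exists_mem_Icc_eq_of_monotoneOn
    ((min_le_left _ _).trans (le_max_left _ _))
    (hψ.mono.mono fun s hs => ha.le.trans hs.1) hlow hup
  exact ⟨s, ha.trans_le hs.1, hfix⟩

lemma le_sqrt_mul (hψ : IsSubRoot ψ) (hrstar : IsTheFixedPoint ψ rstar) (hr : 0 < r)
    (hle : rstar ≤ r) : ψ r ≤ √(r * rstar) := by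
  rcases hrstar.1.1.eq_or_lt with h | h
  · refine le_trans (le_of_not_gt fun hpos => ?_) (Real.sqrt_nonneg _)
    obtain ⟨s, hs, hfix⟩ := hψ.exists_pos_fixedPoint hr hpos
    exact (hrstar.2 ⟨hs.le, hfix⟩).not_gt (h ▸ hs)
  · have hanti : ψ r / √r ≤ ψ rstar / √rstar := hψ.anti h hr hle
    rw [hrstar.1.2, Real.div_sqrt, div_le_iff₀ (Real.sqrt_pos.2 hr)] at hanti
    rwa [Real.sqrt_mul hr.le, mul_comm]

lemma mul_le_of_sq_mul_le (hψ : IsSubRoot ψ) (hrstar : IsTheFixedPoint ψ rstar) (hr : 0 < r)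
    {a : ℝ} (ha : 1 ≤ a) (har : a ^ 2 * rstar ≤ r) : a * ψ r ≤ r := by
  have ha0 : 0 ≤ a := zero_le_one.trans ha
  have hle : rstar ≤ r := (le_mul_of_one_le_left hrstar.1.1 (one_le_pow₀ ha)).trans har
  calc a * ψ r ≤ √(a ^ 2) * √(r * rstar) := by
        rw [Real.sqrt_sq ha0]
        gcongr
        exact hψ.le_sqrt_mul hrstar hr hle
    _ = √(r * (a ^ 2 * rstar)) := by rw [← Real.sqrt_mul (sq_nonneg a), mul_left_comm]
    _ ≤ √(r * r) := by gcongr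
    _ = r := Real.sqrt_mul_self hr.le

end IsSubRoot

end SubRoot

section Peeling

lemma measureReal_le_of_forall_shell_le {Ω : Type*} [MeasurableSpace Ω] {μ : Measure Ω}
    [IsFiniteMeasure μ] {ρ : Ω → ℝ} {r b : ℝ} (hr : 0 < r) (hb : 1 < b) {p : ℕ → ℝ} {P : ℝ}
    (hp : HasSum p P)
    (h : ∀ j, μ.real {ω | r * b ^ j ≤ ρ ω ∧ ρ ω < r * b ^ (j + 1)} ≤ p j) :
    μ.real {ω | r ≤ ρ ω} ≤ P := by
  have hcover : {ω | r ≤ ρ ω} ⊆ ⋃ j, {ω | r * b ^ j ≤ ρ ω ∧ ρ ω < r * b ^ (j + 1)} := by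
    intro ω hω
    obtain ⟨j, hj, hj'⟩ := exists_nat_pow_near ((one_le_div hr).2 hω) hb
    exact Set.mem_iUnion.2 ⟨j, (le_div_iff₀' hr).1 hj, (div_lt_iff₀' hr).1 hj'⟩
  have hp0 : ∀ j, 0 ≤ p j := fun j => measureReal_nonneg.trans (h j)
  refine ENNReal.toReal_le_of_le_ofReal (hp.nonneg hp0) ?_
  calc μ {ω | r ≤ ρ ω}
    _ ≤ ∑' j, μ {ω | r * b ^ j ≤ ρ ω ∧ ρ ω < r * b ^ (j + 1)} :=
        (measure_mono hcover).trans (measure_iUnion_le _)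
    _ ≤ ∑' j, ENNReal.ofReal (p j) := by
        gcongr with j
        exact (ENNReal.le_ofReal_iff_toReal_le (measure_ne_top _ _) (hp0 j)).2 (h j)
    _ = ENNReal.ofReal P := by rw [← ENNReal.ofReal_tsum_of_nonneg hp0 hp.summable, hp.tsum_eq]

lemma exp_neg_mul_four_pow_le {x : ℝ} (hx : 1 ≤ x) (j : ℕ) :
    Real.exp (-(x * 4 ^ (j + 1))) ≤ Real.exp (-x) / 2 / 2 / 2 ^ j := by
  have hpow : (1 : ℝ) + (j + 2) ≤ 4 ^ (j + 1) := by
    have := one_add_mul_le_pow (show (-2 : ℝ) ≤ 3 by norm_num) (j + 1)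
    push_cast at this
    norm_num at this ⊢
    linarith [Nat.cast_nonneg (α := ℝ) j]
  have hexp : (2 : ℝ) ^ (j + 2) ≤ Real.exp (j + 2) := by
    have := pow_le_pow_left₀ zero_le_two (Real.add_one_le_exp 1 |>.trans' (by norm_num)) (j + 2)
    rwa [← Real.exp_nat_mul, mul_one, Nat.cast_add, Nat.cast_two] at this
  calc Real.exp (-(x * 4 ^ (j + 1))) ≤ Real.exp (-x - (j + 2)) := by
        refine Real.exp_le_exp.2 ?_
        nlinarith [mul_le_mul_of_nonneg_left hpow (zero_le_one.trans hx)]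
    _ = Real.exp (-x) / Real.exp (j + 2) := Real.exp_sub _ _
    _ ≤ Real.exp (-x) / 2 ^ (j + 2) := by gcongr
    _ = Real.exp (-x) / 2 / 2 / 2 ^ j := by rw [div_div, div_div, pow_add]; ring_nf

end Peeling

section LocalizedExcess

variable {m u : ℕ} {B L c κ x : ℝ}

namespace IsLocalizedClass

variable {K : Set (Fin (m + u) → ℝ)} {r p : ℝ}

lemma drawLaw_supDev_ge_le_exp (hK : IsLocalizedClass K L r) (hm : 0 < m) (hu : 0 < u)
    (hr : 0 < r) (hB : 0 < B) (hκ1 : 1 ≤ κ) (hκ : 4 * B * (3 + 8 * (16 + 4 * L ^ 2)) ≤ κ)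
    (hc : (min u m : ℕ) ≤ c) (hdev : ∫ d, supDev K (testSet d) ∂(drawLaw m u) ≤ c * p)
    (hsq : ∫ d, supSqDev K (testSet d) ∂(drawLaw m u) ≤ c * p) (hp : 2 * κ * p ≤ r) {y : ℝ}
    (hy : 0 ≤ y) (hyr : κ ^ 2 * y ≤ c * r) :
    (drawLaw m u).real {d | c * r / (4 * B) ≤ supDev K (testSet d)} ≤ Real.exp (-y) := by
  have hκ0 : 0 < κ := zero_lt_one.trans_le hκ1
  have hc0 : 0 ≤ c := (Nat.cast_nonneg _).trans hc
  refine le_trans (measureReal_mono ?_)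
    (hK.drawLaw_supDev_ge_le hm hu hr (ε := 1 / κ) (by positivity) ((div_le_one hκ0).2 hκ1) hy)
  intro d (hd : c * r / (4 * B) ≤ supDev K (testSet d))
  refine le_trans ?_ hd
  have hmean : c * p ≤ c * r / (2 * κ) := by
    rw [le_div_iff₀ (by positivity)]
    linarith [mul_le_mul_of_nonneg_left hp hc0]
  have hvar : 1 / κ * (min u m : ℕ) * r ≤ c * r / κ := by
    rw [one_div_mul_eq_div, div_mul_eq_mul_div]
    gcongr
  have htail : 8 * (16 + 4 * L ^ 2) * y / (1 / κ) ≤ 8 * (16 + 4 * L ^ 2) * (c * r / κ) := by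
    rw [mul_div_assoc, one_div, div_inv_eq_mul]
    gcongr
    rw [le_div_iff₀ hκ0]
    linarith
  calc _ ≤ 4 * (c * r / (2 * κ)) + c * r / κ + 8 * (16 + 4 * L ^ 2) * (c * r / κ) := by linarith
    _ = c * r * (4 * B * (3 + 8 * (16 + 4 * L ^ 2)) / κ) / (4 * B) := by
      field_simp
      ring
    _ ≤ c * r * 1 / (4 * B) := by
      gcongr
      exact (div_le_one hκ0).2 hκ
    _ = c * r / (4 * B) := by rw [mul_one]

lemma drawLaw_supDev_ge_le_div (hK : IsLocalizedClass K L r) (hr : 0 < r) (hB : 0 < B)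
    (hc : 0 < c) (hdev : ∫ d, supDev K (testSet d) ∂(drawLaw m u) ≤ c * p) :
    (drawLaw m u).real {d | c * r / (4 * B) ≤ supDev K (testSet d)} ≤ 4 * B * p / r := by
  have hmarkov := mul_meas_ge_le_integral_of_nonneg (μ := drawLaw m u)
    (.of_forall fun d => hK.supDev_nonneg (testSet d)) .of_finite (c * r / (4 * B))
  rw [← le_div_iff₀' (by positivity)] at hmarkov
  calc _ ≤ _ := hmarkov
    _ ≤ c * p / (c * r / (4 * B)) := by gcongr
    _ = 4 * B * p / r := by field_simp

end IsLocalizedClass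

lemma eight_mul_div_le_exp_neg (hB : 0 < B) (hκ : 24 * B ≤ κ) (hx : x ≤ 1) :
    8 * B / κ ≤ Real.exp (-x) :=
  calc 8 * B / κ ≤ 1 / 3 := by
        rw [div_le_iff₀ (by linarith)]
        linarith
    _ ≤ Real.exp (-1) := by
        rw [Real.exp_neg, one_div]
        exact inv_anti₀ (Real.exp_pos 1) (by linarith [Real.exp_one_lt_d9])
    _ ≤ Real.exp (-x) := Real.exp_le_exp.2 (neg_le_neg hx)

lemma le_sq_mul_add_mul_four_pow {a t : ℝ} (ha : 0 ≤ a) (ht : 0 ≤ t) (hκ1 : 1 ≤ κ) (k : ℕ) :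
    a ≤ κ ^ 2 * (a + t) * 4 ^ k :=
  calc a ≤ a + t := le_add_of_nonneg_right ht
    _ ≤ κ ^ 2 * (a + t) := le_mul_of_one_le_left (add_nonneg ha ht) (one_le_pow₀ hκ1)
    _ ≤ κ ^ 2 * (a + t) * 4 ^ k :=
        le_mul_of_one_le_right (by positivity) (one_le_pow₀ (by norm_num))

lemma IsSubRoot.mul_two_pow_mul_le {ψ : ℝ → ℝ} {rstar t : ℝ} (hψ : IsSubRoot ψ)
    (hrstar : IsTheFixedPoint ψ rstar) (hκ1 : 1 ≤ κ) (ht : 0 < t) (k : ℕ) :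
    κ * 2 ^ k * ψ (κ ^ 2 * (rstar + t) * 4 ^ k) ≤ κ ^ 2 * (rstar + t) * 4 ^ k := by
  have hrstar0 : 0 ≤ rstar := hrstar.1.1
  refine hψ.mul_le_of_sq_mul_le hrstar (by positivity)
    (one_le_mul_of_one_le_of_one_le hκ1 (one_le_pow₀ one_le_two)) ?_
  have hfour : (2 ^ k : ℝ) ^ 2 = 4 ^ k := by
    rw [← pow_mul, mul_comm, pow_mul]
    norm_num
  rw [mul_pow, hfour, mul_right_comm]
  gcongr
  exact le_add_of_nonneg_right ht.le

-- For `x ≥ 1` the exponential bound at `x * 4 ^ (j + 1)` is summable in `j` with the right total;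
-- for `x ≤ 1` Markov's inequality suffices, because `ψ r` is at most `r / (κ * 2 ^ (j + 1))`.
lemma drawLaw_supDev_shell_le (hm : 0 < m) (hu : 0 < u) (hB : 0 < B) (hκ1 : 1 ≤ κ)
    (hκ : 4 * B * (3 + 8 * (16 + 4 * L ^ 2)) ≤ κ) (hc : (min u m : ℕ) ≤ c) {ψ : ℝ → ℝ}
    {rstar : ℝ} (hψ : IsSubRoot ψ) (hrstar : IsTheFixedPoint ψ rstar)
    {K : ℝ → Set (Fin (m + u) → ℝ)} (hK : ∀ r, rstar ≤ r → IsLocalizedClass (K r) L r)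
    (hdev : ∀ r, rstar ≤ r → ∫ d, supDev (K r) (testSet d) ∂(drawLaw m u) ≤ c * ψ r)
    (hsq : ∀ r, rstar ≤ r → ∫ d, supSqDev (K r) (testSet d) ∂(drawLaw m u) ≤ c * ψ r)
    (hx : 0 < x) (j : ℕ) {r : ℝ} (hr : r = κ ^ 2 * (rstar + x / c) * 4 ^ (j + 1)) :
    (drawLaw m u).real {d | c * r / (4 * B) ≤ supDev (K r) (testSet d)} ≤
      Real.exp (-x) / 2 / 2 / 2 ^ j := by
  have : 0 < κ := zero_lt_one.trans_le hκ1
  have hc0 : 0 < c := lt_of_lt_of_le (by exact_mod_cast lt_min hu hm) hc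
  have hrstar0 : 0 ≤ rstar := hrstar.1.1
  have hr0 : 0 < r := by rw [hr]; positivity
  have hle : rstar ≤ r := hr.symm ▸ le_sq_mul_add_mul_four_pow hrstar0 (by positivity) hκ1 (j + 1)
  have hψr : κ * 2 ^ (j + 1) * ψ r ≤ r :=
    hr.symm ▸ hψ.mul_two_pow_mul_le hrstar hκ1 (by positivity) (j + 1)
  rcases le_total 1 x with hx1 | hx1
  · refine le_trans ?_ (exp_neg_mul_four_pow_le hx1 j)
    refine (hK r hle).drawLaw_supDev_ge_le_exp hm hu hr0 hB hκ1 hκ hc (hdev r hle) (hsq r hle)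
      (le_trans ?_ hψr) (by positivity) ?_
    · have hψ0 := hψ.nonneg r hr0.le
      rw [mul_comm 2 κ]
      gcongr
      exact le_self_pow₀ one_le_two j.succ_ne_zero
    · calc κ ^ 2 * (x * 4 ^ (j + 1)) ≤ κ ^ 2 * ((c * rstar + x) * 4 ^ (j + 1)) := by
            gcongr
            exact le_add_of_nonneg_left (by positivity)
        _ = c * r := by
          rw [hr]
          field_simp
  · refine ((hK r hle).drawLaw_supDev_ge_le_div hr0 hB hc0 (hdev r hle)).trans ?_
    calc 4 * B * ψ r / r ≤ 8 * B / κ / 2 / 2 / 2 ^ j := by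
          rw [div_div, div_div, div_div, div_le_div_iff₀ hr0 (by positivity)]
          rw [pow_succ] at hψr
          linarith [mul_le_mul_of_nonneg_left hψr (show 0 ≤ 8 * B by positivity)]
      _ ≤ Real.exp (-x) / 2 / 2 / 2 ^ j := by
          gcongr
          exact eight_mul_div_le_exp_neg hB (by nlinarith [mul_nonneg hB.le (sq_nonneg L)]) hx1

theorem drawLaw_excess_ge_le (hm : 0 < m) (hu : 0 < u) (hB : 0 < B) (hκ1 : 1 ≤ κ)
    (hκ : 4 * B * (3 + 8 * (16 + 4 * L ^ 2)) ≤ κ) (hc : (min u m : ℕ) ≤ c) {ψ : ℝ → ℝ}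
    {rstar : ℝ} (hψ : IsSubRoot ψ) (hrstar : IsTheFixedPoint ψ rstar)
    {K : ℝ → Set (Fin (m + u) → ℝ)} (hK : ∀ r, rstar ≤ r → IsLocalizedClass (K r) L r)
    (hdev : ∀ r, rstar ≤ r → ∫ d, supDev (K r) (testSet d) ∂(drawLaw m u) ≤ c * ψ r)
    (hsq : ∀ r, rstar ≤ r → ∫ d, supSqDev (K r) (testSet d) ∂(drawLaw m u) ≤ c * ψ r)
    {ρ : Draws m u → ℝ} {q : Draws m u → Fin (m + u) → ℝ} (hq : ∀ d r, ρ d ≤ r → q d ∈ K r)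
    (hρ : ∀ d, c * ρ d ≤ B * centeredSum (q d) (testSet d)) (hx : 0 < x) :
    (drawLaw m u).real {d | κ ^ 2 * (rstar + x / c) ≤ ρ d} ≤ Real.exp (-x) / 2 := by
  have hc0 : 0 < c := lt_of_lt_of_le (by exact_mod_cast lt_min hu hm) hc
  have hrstar0 : 0 ≤ rstar := hrstar.1.1
  have hr₀ : 0 < κ ^ 2 * (rstar + x / c) := by positivity
  refine measureReal_le_of_forall_shell_le hr₀ (b := 4) (by norm_num)
    (hasSum_geometric_two' (Real.exp (-x) / 2)) fun j =>
    (measureReal_mono ?_).trans (drawLaw_supDev_shell_le hm hu hB hκ1 hκ hc hψ hrstar hK hdev hsq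
      hx j rfl)
  intro d ⟨hlow, hup⟩
  have hle := le_sq_mul_add_mul_four_pow hrstar0 (show 0 ≤ x / c by positivity) hκ1 (j + 1)
  calc c * (κ ^ 2 * (rstar + x / c) * 4 ^ (j + 1)) / (4 * B)
      = c * (κ ^ 2 * (rstar + x / c) * 4 ^ j) / B := by
        field_simp
        rw [pow_succ, mul_comm]
    _ ≤ c * ρ d / B := by gcongr
    _ ≤ centeredSum (q d) (testSet d) := (div_le_iff₀' hB).2 (hρ d)
    _ ≤ supDev (K _) (testSet d) :=
        (hK _ hle).centeredSum_le_supDev (subset_closure (hq d _ hup.le)) _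

end LocalizedExcess

section Transfer

variable {α β : Type*} {m u : ℕ}

lemma fullAvg_sub (S : Fin (m + u) → α × β) (f g : α × β → ℝ) :
    fullAvg S (f - g) = fullAvg S f - fullAvg S g := by
  simp only [fullAvg, Pi.sub_apply, Finset.sum_sub_distrib, mul_sub]

lemma testAvg_sub (S : Fin (m + u) → α × β) (d : Draws m u) (f g : α × β → ℝ) :
    testAvg S d (f - g) = testAvg S d f - testAvg S d g := by
  simp only [testAvg, Pi.sub_apply, Finset.sum_sub_distrib, mul_sub]

lemma trainAvg_sub (S : Fin (m + u) → α × β) (d : Draws m u) (f g : α × β → ℝ) :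
    trainAvg S d (f - g) = trainAvg S d f - trainAvg S d g := by
  simp only [trainAvg, Pi.sub_apply, Finset.sum_sub_distrib, mul_sub]

lemma mul_Rplus_u (hu : 0 < u) (S : Fin (m + u) → α × β) (d : Draws m u) (h : α × β → ℝ) :
    u * Rplus_u S d h = centeredSum (fun i => h (S i)) (testSet d) := by
  have hu0 : (u : ℝ) ≠ 0 := by exact_mod_cast hu.ne'
  rw [Rplus_u, testAvg, fullAvg, centeredSum_eq_sum_sub, card_testSet, Fintype.card_fin]
  field_simp

lemma mul_Rplus_m (hm : 0 < m) (S : Fin (m + u) → α × β) (d : Draws m u) (h : α × β → ℝ) :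
    m * Rplus_m S d h = centeredSum (fun i => h (S i)) (trainSet d) := by
  have hm0 : (m : ℝ) ≠ 0 := by exact_mod_cast hm.ne'
  rw [Rplus_m, trainAvg, fullAvg, centeredSum_eq_sum_sub, card_trainSet, Fintype.card_fin]
  field_simp

lemma mul_Rplus_min (hm : 0 < m) (hu : 0 < u) (S : Fin (m + u) → α × β) (d : Draws m u)
    (h : α × β → ℝ) :
    (min u m : ℕ) * Rplus_min S d h = centeredSum (fun i => h (S i)) (smallPart (testSet d)) := by
  unfold Rplus_min smallPart
  rw [← trainSet, card_testSet, card_trainSet]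
  split_ifs with hum
  · rw [min_eq_left hum, mul_Rplus_u hu]
  · rw [min_eq_right (not_le.1 hum).le, mul_Rplus_m hm]

/-- The restrictions to the sample of the functions of a class `H`, multiplied by a sign `σ`. -/
def signedTrace (S : Fin (m + u) → α × β) (σ : ℝ) (H : Set (α × β → ℝ)) :
    Set (Fin (m + u) → ℝ) :=
  (fun h i => σ * h (S i)) '' H

lemma mul_expSup {R : Draws m u → (α × β → ℝ) → ℝ} {H : Set (α × β → ℝ)} {c : ℝ} (hc : 0 ≤ c) :
    c * expSup R H = ∫ d, sSup ((fun h => c * R d h) '' H) ∂(drawLaw m u) := by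
  rw [expSup, ← integral_const_mul]
  congr 1 with d
  rw [← smul_eq_mul, ← Real.sSup_smul_of_nonneg hc, ← Set.image_smul, Set.image_image]
  rfl

lemma integral_supDev_signedTrace {S : Fin (m + u) → α × β} {σ c : ℝ}
    {R : Draws m u → (α × β → ℝ) → ℝ} (hc : 0 ≤ c)
    (hR : ∀ d h, c * R d h = centeredSum (fun i => σ * h (S i)) (testSet d))
    (H : Set (α × β → ℝ)) :
    ∫ d, supDev (signedTrace S σ H) (testSet d) ∂(drawLaw m u) = c * expSup R H := by
  simp only [mul_expSup hc, hR, supDev, signedTrace, Set.image_image]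

lemma integral_supSqDev_signedTrace (hm : 0 < m) (hu : 0 < u) (S : Fin (m + u) → α × β) {σ : ℝ}
    (hσ : σ ^ 2 = 1) (H : Set (α × β → ℝ)) :
    ∫ d, supSqDev (signedTrace S σ H) (testSet d) ∂(drawLaw m u) =
      (min u m : ℕ) * expSup (fun d h => Rplus_min S d (h ^ 2)) H := by
  have hsq : ∀ h : α × β → ℝ, (fun i => σ * h (S i)) ^ 2 = fun i => (h ^ 2) (S i) := by
    intro h
    ext i
    simp only [Pi.pow_apply, mul_pow, hσ, one_mul]
  simp only [mul_expSup (Nat.cast_nonneg _), mul_Rplus_min hm hu, supSqDev, signedTrace,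
    Set.image_image, hsq]

lemma fullAvg_le_Rminus_u {S : Fin (m + u) → α × β} {d : Draws m u} {ℓ : ℝ → β → ℝ}
    {F : Set (α → ℝ)} {f fstar : α → ℝ} (hf : IsMinOn (fun f => testAvg S d (lossFun ℓ f)) F f)
    (hfstar : fstar ∈ F) :
    fullAvg S (lossFun ℓ f - lossFun ℓ fstar) ≤ Rminus_u S d (lossFun ℓ f - lossFun ℓ fstar) := by
  have hle : testAvg S d (lossFun ℓ f) ≤ testAvg S d (lossFun ℓ fstar) := hf hfstar
  rw [Rminus_u, Rplus_u, neg_sub, testAvg_sub]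
  linarith

lemma fullAvg_le_Rminus_m {S : Fin (m + u) → α × β} {d : Draws m u} {ℓ : ℝ → β → ℝ}
    {F : Set (α → ℝ)} {f fstar : α → ℝ} (hf : IsMinOn (fun f => trainAvg S d (lossFun ℓ f)) F f)
    (hfstar : fstar ∈ F) :
    fullAvg S (lossFun ℓ f - lossFun ℓ fstar) ≤ Rminus_m S d (lossFun ℓ f - lossFun ℓ fstar) := by
  have hle : trainAvg S d (lossFun ℓ f) ≤ trainAvg S d (lossFun ℓ fstar) := hf hfstar
  rw [Rminus_m, Rplus_m, neg_sub, trainAvg_sub]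
  linarith

namespace MainAssumption

variable {S : Fin (m + u) → α × β} {ℓ : ℝ → β → ℝ} {F : Set (α → ℝ)} {fstar : α → ℝ} {B L : ℝ}

lemma fullAvg_nonneg (hA : MainAssumption S ℓ F fstar B) {h : α × β → ℝ}
    (hh : h ∈ deltaStar ℓ F fstar) : 0 ≤ fullAvg S h := by
  obtain ⟨f, hf, rfl⟩ := hh
  rw [fullAvg_sub, sub_nonneg]
  exact hA.isMinOn hf

lemma sum_sq_le (hA : MainAssumption S ℓ F fstar B) (hn : 0 < m + u) {h : α × β → ℝ}
    (hh : h ∈ deltaStar ℓ F fstar) : ∑ i, h (S i) ^ 2 ≤ (m + u : ℕ) * (B * fullAvg S h) := by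
  have hle := hA.sqAvg_le h hh
  rwa [fullSqAvg, one_div, inv_mul_le_iff₀ (by exact_mod_cast hn)] at hle

lemma fullAvg_eq_zero (hA : MainAssumption S ℓ F fstar B) (hB : B ≤ 0) (hn : 0 < m + u)
    {h : α × β → ℝ} (hh : h ∈ deltaStar ℓ F fstar) : fullAvg S h = 0 := by
  have hsum : ∑ i, h (S i) ^ 2 ≤ 0 := (hA.sum_sq_le hn hh).trans <|
    mul_nonpos_of_nonneg_of_nonpos (Nat.cast_nonneg _)
      (mul_nonpos_of_nonpos_of_nonneg hB (hA.fullAvg_nonneg hh))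
  have hzero : ∀ i, h (S i) = 0 := fun i => sq_nonpos_iff _ |>.1 <|
    (Finset.single_le_sum (fun i _ => sq_nonneg (h (S i))) (Finset.mem_univ i)).trans hsum
  simp only [fullAvg, hzero, Finset.sum_const_zero, mul_zero]

lemma isLocalizedClass_signedTrace (hA : MainAssumption S ℓ F fstar B)
    (hL : ∀ h ∈ deltaStar ℓ F fstar, ∀ i, |h (S i)| ≤ L) (hn : 0 < m + u) {σ r : ℝ}
    (hσ : σ ^ 2 = 1) (hr : 0 ≤ r) :
    IsLocalizedClass (signedTrace S σ (localDeltaStar S ℓ F fstar B r)) L r where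
  zero_mem := by
    refine ⟨0, ⟨⟨fstar, hA.mem, (sub_self _).symm⟩, ?_⟩, ?_⟩
    · simpa [fullAvg] using hr
    · exact funext fun _ => mul_zero σ
  abs_le := by
    rintro _ ⟨h, hh, rfl⟩ i
    have hσ1 : |σ| = 1 := by rwa [← abs_one, ← sq_eq_sq_iff_abs_eq_abs, one_pow]
    rw [abs_mul, hσ1, one_mul]
    exact hL h hh.1 i
  sum_sq_le := by
    rintro _ ⟨h, hh, rfl⟩
    simp only [mul_pow, hσ, one_mul, Fintype.card_fin]
    exact (hA.sum_sq_le hn hh.1).trans (by gcongr; exact hh.2)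

lemma drawLaw_excess_ge_le (hA : MainAssumption S ℓ F fstar B)
    (hL : ∀ h ∈ deltaStar ℓ F fstar, ∀ i, |h (S i)| ≤ L) (hm : 0 < m) (hu : 0 < u) (hB : 0 < B)
    {κ : ℝ} (hκ1 : 1 ≤ κ) (hκ : 4 * B * (3 + 8 * (16 + 4 * L ^ 2)) ≤ κ) {ψ : ℝ → ℝ} {rstar : ℝ}
    (hψ : IsSubRoot ψ) (hrstar : IsTheFixedPoint ψ rstar) {R : Draws m u → (α × β → ℝ) → ℝ}
    {σ c : ℝ} (hσ : σ ^ 2 = 1) (hc : (min u m : ℕ) ≤ c)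
    (hR : ∀ d h, c * R d h = centeredSum (fun i => σ * h (S i)) (testSet d))
    (hdev : ∀ r, rstar ≤ r → expSup R (localDeltaStar S ℓ F fstar B r) ≤ ψ r)
    (hsq : ∀ r, rstar ≤ r →
      expSup (fun d h => Rplus_min S d (h ^ 2)) (localDeltaStar S ℓ F fstar B r) ≤ ψ r)
    {g : Draws m u → α × β → ℝ} (hg : ∀ d, g d ∈ deltaStar ℓ F fstar)
    (hgR : ∀ d, fullAvg S (g d) ≤ R d (g d)) {x : ℝ} (hx : 0 < x) :
    (drawLaw m u).real {d | κ ^ 2 * (rstar + x / c) ≤ B * fullAvg S (g d)} ≤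
      Real.exp (-x) / 2 := by
  have hc0 : 0 ≤ c := (Nat.cast_nonneg _).trans hc
  have hrstar0 : 0 ≤ rstar := hrstar.1.1
  refine Transductive.drawLaw_excess_ge_le (q := fun d i => σ * g d (S i)) hm hu hB hκ1 hκ hc hψ
    hrstar (K := fun r => signedTrace S σ (localDeltaStar S ℓ F fstar B r))
    (fun r hr => hA.isLocalizedClass_signedTrace hL (by lia) hσ (hrstar0.trans hr)) (fun r hr => ?_)
    (fun r hr => ?_) (fun d r hr => ⟨g d, ⟨hg d, hr⟩, rfl⟩) (fun d => ?_) hx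
  · rw [integral_supDev_signedTrace hc0 hR]
    gcongr
    exact hdev r hr
  · rw [integral_supSqDev_signedTrace hm hu S hσ]
    have hψ0 : 0 ≤ ψ r := hψ.nonneg r (hrstar0.trans hr)
    exact (mul_le_mul_of_nonneg_left (hsq r hr) (Nat.cast_nonneg _)).trans (by gcongr)
  · rw [← hR, mul_left_comm]
    gcongr
    exact hgR d

lemma drawLaw_test_excess_ge_le (hA : MainAssumption S ℓ F fstar B)
    (hL : ∀ h ∈ deltaStar ℓ F fstar, ∀ i, |h (S i)| ≤ L) (hm : 0 < m) (hu : 0 < u) (hB : 0 < B)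
    {κ : ℝ} (hκ1 : 1 ≤ κ) (hκ : 4 * B * (3 + 8 * (16 + 4 * L ^ 2)) ≤ κ) {ψ : ℝ → ℝ} {rstar : ℝ}
    (hψ : IsSubRoot ψ) (hrstar : IsTheFixedPoint ψ rstar)
    (hdev : ∀ r, rstar ≤ r → expSup (Rminus_u S) (localDeltaStar S ℓ F fstar B r) ≤ ψ r)
    (hsq : ∀ r, rstar ≤ r →
      expSup (fun d h => Rplus_min S d (h ^ 2)) (localDeltaStar S ℓ F fstar B r) ≤ ψ r)
    {f : Draws m u → α → ℝ}
    (hf : ∀ d, f d ∈ F ∧ IsMinOn (fun f => testAvg S d (lossFun ℓ f)) F (f d))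
    {x : ℝ} (hx : 0 < x) :
    (drawLaw m u).real {d | κ ^ 2 * (rstar + x / u) ≤
      B * fullAvg S (lossFun ℓ (f d) - lossFun ℓ fstar)} ≤ Real.exp (-x) / 2 := by
  refine hA.drawLaw_excess_ge_le hL hm hu hB hκ1 hκ hψ hrstar (σ := -1) neg_one_sq
    (by exact_mod_cast min_le_left u m) (fun d h => ?_) hdev hsq (fun d => ⟨f d, (hf d).1, rfl⟩)
    (fun d => fullAvg_le_Rminus_u (hf d).2 hA.mem) hx
  rw [Rminus_u, mul_neg, mul_Rplus_u hu, centeredSum_const_mul, neg_one_mul]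

lemma drawLaw_train_excess_ge_le (hA : MainAssumption S ℓ F fstar B)
    (hL : ∀ h ∈ deltaStar ℓ F fstar, ∀ i, |h (S i)| ≤ L) (hm : 0 < m) (hu : 0 < u) (hB : 0 < B)
    {κ : ℝ} (hκ1 : 1 ≤ κ) (hκ : 4 * B * (3 + 8 * (16 + 4 * L ^ 2)) ≤ κ) {ψ : ℝ → ℝ} {rstar : ℝ}
    (hψ : IsSubRoot ψ) (hrstar : IsTheFixedPoint ψ rstar)
    (hdev : ∀ r, rstar ≤ r → expSup (Rminus_m S) (localDeltaStar S ℓ F fstar B r) ≤ ψ r)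
    (hsq : ∀ r, rstar ≤ r →
      expSup (fun d h => Rplus_min S d (h ^ 2)) (localDeltaStar S ℓ F fstar B r) ≤ ψ r)
    {f : Draws m u → α → ℝ}
    (hf : ∀ d, f d ∈ F ∧ IsMinOn (fun f => trainAvg S d (lossFun ℓ f)) F (f d))
    {x : ℝ} (hx : 0 < x) :
    (drawLaw m u).real {d | κ ^ 2 * (rstar + x / m) ≤
      B * fullAvg S (lossFun ℓ (f d) - lossFun ℓ fstar)} ≤ Real.exp (-x) / 2 := by
  refine hA.drawLaw_excess_ge_le hL hm hu hB hκ1 hκ hψ hrstar (σ := 1) (one_pow 2)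
    (by exact_mod_cast min_le_right u m) (fun d h => ?_) hdev hsq (fun d => ⟨f d, (hf d).1, rfl⟩)
    (fun d => fullAvg_le_Rminus_m (hf d).2 hA.mem) hx
  rw [Rminus_m, mul_neg, mul_Rplus_m hm, trainSet, centeredSum_compl, neg_neg,
    centeredSum_const_mul, one_mul]

end MainAssumption

lemma one_sub_le_measureReal_of_le {Ω : Type*} [MeasurableSpace Ω] {μ : Measure Ω}
    [IsProbabilityMeasure μ] {b : ℝ} {s t G : Set Ω} (hs : μ.real s ≤ b / 2)
    (ht : μ.real t ≤ b / 2) (hG : sᶜ ∩ tᶜ ⊆ G) : 1 - b ≤ μ.real G := by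
  have huniv : Set.univ ⊆ G ∪ (s ∪ t) := fun ω _ => by
    by_contra hω
    simp only [Set.mem_union, not_or] at hω
    exact hω.1 (hG ⟨hω.2.1, hω.2.2⟩)
  have hle := (measureReal_mono huniv).trans (measureReal_union_le (μ := μ) G (s ∪ t))
  rw [probReal_univ] at hle
  linarith [measureReal_union_le (μ := μ) s t]

lemma abs_le_of_mem_deltaStar {S : Fin (m + u) → α × β} {ℓ : ℝ → β → ℝ} {F : Set (α → ℝ)}
    {fstar : α → ℝ} {L₀ : ℝ} (hℓ : ∀ f ∈ F, ∀ i, 0 ≤ lossFun ℓ f (S i) ∧ lossFun ℓ f (S i) ≤ L₀)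
    (hfstar : fstar ∈ F) {h : α × β → ℝ} (hh : h ∈ deltaStar ℓ F fstar) (i : Fin (m + u)) :
    |h (S i)| ≤ L₀ := by
  obtain ⟨f, hf, rfl⟩ := hh
  exact abs_sub_le_of_nonneg_of_le (hℓ f hf i).1 (hℓ f hf i).2 (hℓ fstar hfstar i).1
    (hℓ fstar hfstar i).2

end Transfer

end Transductive

theorem mainTheorem8_general (B L : ℝ) :
    ∃ c₂ : ℝ, 0 < c₂ ∧
      ∀ (m u : ℕ), 0 < m → 0 < u →
      ∀ (α β : Type*) (S : Fin (m + u) → α × β) (ℓ : ℝ → β → ℝ) (F : Set (α → ℝ))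
        (fstar : α → ℝ),
      (∀ h ∈ Transductive.deltaStar ℓ F fstar, ∀ i, |h (S i)| ≤ L) →
      Transductive.MainAssumption S ℓ F fstar B →
      ∀ (ψ : ℝ → ℝ) (rstar : ℝ),
      Transductive.IsSubRoot ψ →
      Transductive.IsTheFixedPoint ψ rstar →
      (∀ r, rstar ≤ r →
        max (Transductive.expSup (Transductive.Rminus_u S)
              (Transductive.localDeltaStar S ℓ F fstar B r))
          (max (Transductive.expSup (Transductive.Rminus_m S)
                (Transductive.localDeltaStar S ℓ F fstar B r))
            (Transductive.expSup (fun d h => Transductive.Rplus_min S d (h ^ 2))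
              (Transductive.localDeltaStar S ℓ F fstar B r))) ≤ ψ r) →
      ∀ (fhat_u fhat_m : Transductive.Draws m u → (α → ℝ)),
      (∀ d, fhat_u d ∈ F ∧
        IsMinOn (fun f => Transductive.testAvg S d (Transductive.lossFun ℓ f)) F (fhat_u d)) →
      (∀ d, fhat_m d ∈ F ∧
        IsMinOn (fun f => Transductive.trainAvg S d (Transductive.lossFun ℓ f)) F (fhat_m d)) →
      ∀ x : ℝ, 0 < x →
        1 - Real.exp (-x) ≤ (Transductive.drawLaw m u).real
          {d | Transductive.fullAvg S
                (Transductive.lossFun ℓ (fhat_u d) - Transductive.lossFun ℓ fstar)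
                  ≤ c₂ * (rstar + x / u) ∧
               Transductive.fullAvg S
                (Transductive.lossFun ℓ (fhat_m d) - Transductive.lossFun ℓ fstar)
                  ≤ c₂ * (rstar + x / m)} := by
  rcases le_or_gt B 0 with hB | hB
  · refine ⟨1, one_pos, fun m u _ hu α β S ℓ F fstar _ hA ψ rstar _ hrstar _ fhat_u fhat_m hfu hfm
      x hx => ?_⟩
    have hrstar0 : 0 ≤ rstar := hrstar.1.1
    refine (sub_le_self 1 (Real.exp_nonneg _)).trans_eq ?_
    rw [← probReal_univ (μ := Transductive.drawLaw m u), eq_comm]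
    congr 1
    refine Set.eq_univ_of_forall fun d => ⟨?_, ?_⟩
    · rw [hA.fullAvg_eq_zero hB (by lia) ⟨_, (hfu d).1, rfl⟩]
      positivity
    · rw [hA.fullAvg_eq_zero hB (by lia) ⟨_, (hfm d).1, rfl⟩]
      positivity
  obtain ⟨κ, hκ1, hκ⟩ : ∃ κ : ℝ, 1 ≤ κ ∧ 4 * B * (3 + 8 * (16 + 4 * L ^ 2)) ≤ κ :=
    ⟨_, le_max_left _ _, le_max_right _ _⟩
  refine ⟨κ ^ 2 / B, by positivity, fun m u hm hu α β S ℓ F fstar hL hA ψ rstar hψ hrstar hbound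
    fhat_u fhat_m hfu hfm x hx => ?_⟩
  simp only [max_le_iff] at hbound
  have htest := hA.drawLaw_test_excess_ge_le hL hm hu hB hκ1 hκ hψ hrstar
    (fun r hr => (hbound r hr).1) (fun r hr => (hbound r hr).2.2) hfu hx
  have htrain := hA.drawLaw_train_excess_ge_le hL hm hu hB hκ1 hκ hψ hrstar
    (fun r hr => (hbound r hr).2.1) (fun r hr => (hbound r hr).2.2) hfm hx
  refine Transductive.one_sub_le_measureReal_of_le htest htrain fun d hd => ?_
  simp only [Set.mem_inter_iff, Set.mem_compl_iff, Set.mem_ofPred_eq, not_le] at hd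
  simp only [Set.mem_ofPred_eq, div_mul_eq_mul_div, le_div_iff₀' hB]
  exact ⟨hd.1.le, hd.2.le⟩

theorem mainTheorem8 (B L₀ : ℝ) (hL₀ : 2 * √2 ≤ L₀) :
    ∃ c₂ : ℝ, 0 < c₂ ∧
      ∀ (m u : ℕ), 0 < m → 0 < u →
      ∀ (dim : ℕ) (X : Set (EuclideanSpace ℝ (Fin dim))) (Y : Set ℝ)
        (S : Fin (m + u) → X × Y) (ℓ : ℝ → Y → ℝ) (F : Set (X → ℝ)) (fstar : X → ℝ),
      (∀ f ∈ F, ∀ i, 0 ≤ Transductive.lossFun ℓ f (S i) ∧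
        Transductive.lossFun ℓ f (S i) ≤ L₀) →
      Transductive.MainAssumption S ℓ F fstar B →
      ∀ (ψ : ℝ → ℝ) (rstar : ℝ),
      Transductive.IsSubRoot ψ →
      Transductive.IsTheFixedPoint ψ rstar →
      (∀ r, rstar ≤ r →
        max (Transductive.expSup (Transductive.Rminus_u S)
              (Transductive.localDeltaStar S ℓ F fstar B r))
          (max (Transductive.expSup (Transductive.Rminus_m S)
                (Transductive.localDeltaStar S ℓ F fstar B r))
            (Transductive.expSup (fun d h => Transductive.Rplus_min S d (h ^ 2))
              (Transductive.localDeltaStar S ℓ F fstar B r))) ≤ ψ r) →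
      ∀ (fhat_u fhat_m : Transductive.Draws m u → (X → ℝ)),
      (∀ d, fhat_u d ∈ F ∧
        IsMinOn (fun f => Transductive.testAvg S d (Transductive.lossFun ℓ f)) F (fhat_u d)) →
      (∀ d, fhat_m d ∈ F ∧
        IsMinOn (fun f => Transductive.trainAvg S d (Transductive.lossFun ℓ f)) F (fhat_m d)) →
      ∀ x : ℝ, 0 < x →
        1 - Real.exp (-x) ≤ (Transductive.drawLaw m u).real
          {d | Transductive.fullAvg S
                (Transductive.lossFun ℓ (fhat_u d) - Transductive.lossFun ℓ fstar)
                  ≤ c₂ * (rstar + x / u) ∧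
               Transductive.fullAvg S
                (Transductive.lossFun ℓ (fhat_m d) - Transductive.lossFun ℓ fstar)
                  ≤ c₂ * (rstar + x / m)} := by
  obtain ⟨c₂, hc₂, hbound⟩ := mainTheorem8_general.{0, 0} B L₀
  exact ⟨c₂, hc₂, fun m u hm hu _ X Y S ℓ F fstar hℓ hA => hbound m u hm hu X Y S ℓ F fstar
    (fun _ hh => Transductive.abs_le_of_mem_deltaStar hℓ hA.mem hh) hA⟩
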